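/- Let $k$ be a commutative $\mathbb{Q}$-algebra (for example a field of characteristic zero), let $V=V_0\oplus V_1$ be a $\mathbb{Z}_2$-graded $k$-module, and let $W=\Pi V$ be its parity reversion. Let $\bigodot W=\bigoplus_{n\ge 1}\bigodot^n W$ be the reduced symmetric coalgebra of $W$ (graded by parity, with the reduced unshuffle diagonal $\Delta$). An $L_\infty$ algebra structure on $V$ is an odd codifferential $d$ on $\bigodot W$, i.e. an odd coderivation with $d^2=0$. Let $l:\bigodot W\to W$ be the cochain given by the degree-one component of $d$. The cochains are $C(V):=\operatorname{Hom}(\bigodot W,W)$; each cochain $\varphi$ extends to $\bigodot W$ by $$\hat\varphi(w_1\odot\cdots\odot w_n)=\sum_{1\le p\le n}\ \sum_{\sigma\in \mathrm{Sh}(p,n-p)}\epsilon(\sigma)\,\varphi(w_{\sigma(1)}\odot\cdots\odot w_{\sigma(p)})\odot w_{\sigma(p+1)}\odot\cdots\odot w_{\sigma(n)},$$ where $\epsilon(\sigma)$ is the Koszul sign, and for homogeneous cochains $[\varphi,\psi]=\varphi\circ\hat\psi-(-1)^{|\varphi||\psi|}\psi\circ\hat\varphi$. Put $D(\varphi)=[\varphi,l]$.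 Then $D$ is an odd map with $D^2=0$; let $H(V)=\ker D/\operatorname{im}D=H(V)_0\oplus H(V)_1$ be its cohomology. It classifies the infinitesimal deformations in the following sense. Let $t$ be a parameter of parity $s\in\mathbb{Z}_2$ with $t^2=0$ and $xt=(-1)^{s|x|}tx$. An infinitesimal deformation of $d$ (with parameter $t$) is an odd codifferential on the coalgebra $\bigodot W[t]$ over $k[t]$ which reduces to $d$ modulo $t$; it is trivial if an automorphism (even, $k[t]$-linear) of the graded coalgebra $\bigodot W[t]$ takes $d$ to it. For each $s$: 1. every infinitesimal deformation is $d+t\hat\delta$ for a unique cochain $\delta\in C(V)$ of parity $s+1$; and for $\delta$ of parity $s+1$, $d+t\hat\delta$ is an infinitesimal deformation if and only if $D(\delta)=0$; 2. for $\delta$ of parity $s+1$, $d+t\hat\delta$ is trivial if and only if $\delta$ is a coboundary, i.e. $\delta=D(\lambda)$ for a cochain $\lambda$ of parity $s$; 3. $d+t\hat\delta\mapsto[\delta]$ induces a bijection from the infinitesimal deformations with parameter of parity $s$, modulo the automorphisms of the coalgebra $\bigodot W[t]$ that are the identity modulo $t$, to $H(V)_{s+1}$. -/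

import Mathlib

open scoped TensorProduct

namespace LInfinity

noncomputable section

/-! ### Graded modules

A `ℤ₂`-graded `k`-module is a module `W` with submodules `𝒲 0` (even) and `𝒲 1` (odd) such that
`W = 𝒲 0 ⊕ 𝒲 1`. -/

section Graded

variable {k : Type*} [CommRing k] {W : Type*} [AddCommGroup W] [Module k W]

/-- The sign `(-1)^(ab)` of two parities. -/
def sgn (k : Type*) [CommRing k] (a b : ZMod 2) : k := (-1) ^ (a.val * b.val)

/-- The parity reversion `ΠV`: the same module, with the parity of the elements reversed. -/
def parityRev (𝒱 : ZMod 2 → Submodule k W) : ZMod 2 → Submodule k W := fun i => 𝒱 (i + 1)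

/-- The projection to the component of parity `i`. -/
def proj (𝒲 : ZMod 2 → Submodule k W) [DirectSum.Decomposition 𝒲] (i : ZMod 2) : W →ₗ[k] W :=
  (𝒲 i).subtype ∘ₗ DirectSum.component k (ZMod 2) (fun j => 𝒲 j) i ∘ₗ
    (DirectSum.decomposeLinearEquiv 𝒲).toLinearMap

theorem proj_same (𝒲 : ZMod 2 → Submodule k W) [DirectSum.Decomposition 𝒲] {i : ZMod 2} {x : W}
    (hx : x ∈ 𝒲 i) : proj 𝒲 i x = x :=
  DirectSum.decompose_of_mem_same 𝒲 hx

theorem proj_ne (𝒲 : ZMod 2 → Submodule k W) [DirectSum.Decomposition 𝒲] {i j : ZMod 2} {x : W}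
    (hx : x ∈ 𝒲 i) (hij : i ≠ j) : proj 𝒲 j x = 0 :=
  DirectSum.decompose_of_mem_ne 𝒲 hx hij

theorem zmod_two_cases (i : ZMod 2) : i = 0 ∨ i = 1 := by
  revert i; decide

theorem proj_add_proj (𝒲 : ZMod 2 → Submodule k W) [DirectSum.Decomposition 𝒲] (x : W) :
    proj 𝒲 0 x + proj 𝒲 1 x = x := by
  induction x using DirectSum.Decomposition.inductionOn 𝒲 with
  | zero => simp
  | @homogeneous i m =>
    rcases zmod_two_cases i with rfl | rfl
    · rw [proj_same 𝒲 m.2, proj_ne 𝒲 m.2 (by decide), add_zero]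
    · rw [proj_same 𝒲 m.2, proj_ne 𝒲 m.2 (by decide), zero_add]
  | add m n hm hn => rw [map_add, map_add, add_add_add_comm, hm, hn]

theorem proj_mem (𝒲 : ZMod 2 → Submodule k W) [DirectSum.Decomposition 𝒲] (i : ZMod 2) (x : W) :
    proj 𝒲 i x ∈ 𝒲 i :=
  (DirectSum.decompose 𝒲 x i).2

/-- The decomposition of `x` with respect to the reversed parity. -/
def parityRevDecompose (𝒱 : ZMod 2 → Submodule k W) [DirectSum.Decomposition 𝒱] (x : W) :
    DirectSum (ZMod 2) fun i => parityRev 𝒱 i :=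
  DirectSum.of (fun i => parityRev 𝒱 i) 0 ⟨proj 𝒱 1 x, proj_mem 𝒱 1 x⟩ +
    DirectSum.of (fun i => parityRev 𝒱 i) 1 ⟨proj 𝒱 0 x, proj_mem 𝒱 0 x⟩

instance parityRevDecomposition (𝒱 : ZMod 2 → Submodule k W) [DirectSum.Decomposition 𝒱] :
    DirectSum.Decomposition (parityRev 𝒱) where
  decompose' := parityRevDecompose 𝒱
  left_inv x := by
    rw [parityRevDecompose, map_add, DirectSum.coeAddMonoidHom_of, DirectSum.coeAddMonoidHom_of]
    exact (add_comm _ _).trans (proj_add_proj 𝒱 x)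
  right_inv y := by
    induction y using DirectSum.induction_on with
    | zero =>
      rw [map_zero, parityRevDecompose]
      simp only [map_zero]
      exact (congrArg₂ (· + ·) (map_zero _) (map_zero _)).trans (add_zero 0)
    | of i m =>
      have hm : (m : W) ∈ 𝒱 (i + 1) := m.2
      rw [DirectSum.coeAddMonoidHom_of, parityRevDecompose]
      rcases zmod_two_cases i with rfl | rfl
      · have h1 : (⟨proj 𝒱 1 m, proj_mem 𝒱 1 m⟩ : parityRev 𝒱 0) = m :=
          Subtype.ext (proj_same 𝒱 (i := 1) hm)
        have h0 : (⟨proj 𝒱 0 m, proj_mem 𝒱 0 m⟩ : parityRev 𝒱 1) = 0 :=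
          Subtype.ext (proj_ne 𝒱 (i := 1) hm (by decide))
        rw [h1, h0, map_zero, add_zero]
      · have h1 : (⟨proj 𝒱 1 m, proj_mem 𝒱 1 m⟩ : parityRev 𝒱 0) = 0 :=
          Subtype.ext (proj_ne 𝒱 (i := 0) hm (by decide))
        have h0 : (⟨proj 𝒱 0 m, proj_mem 𝒱 0 m⟩ : parityRev 𝒱 1) = m :=
          Subtype.ext (proj_same 𝒱 (i := 0) hm)
        rw [h1, h0, map_zero, zero_add]
    | add a b ha hb =>
      rw [map_add]
      conv_rhs => rw [← ha, ← hb]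
      have e0 : ∀ u v : W, (⟨proj 𝒱 1 (u + v), proj_mem 𝒱 1 (u + v)⟩ : parityRev 𝒱 0) =
          ⟨proj 𝒱 1 u, proj_mem 𝒱 1 u⟩ + ⟨proj 𝒱 1 v, proj_mem 𝒱 1 v⟩ :=
        fun u v => Subtype.ext (map_add _ _ _)
      have e1 : ∀ u v : W, (⟨proj 𝒱 0 (u + v), proj_mem 𝒱 0 (u + v)⟩ : parityRev 𝒱 1) =
          ⟨proj 𝒱 0 u, proj_mem 𝒱 0 u⟩ + ⟨proj 𝒱 0 v, proj_mem 𝒱 0 v⟩ :=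
        fun u v => Subtype.ext (map_add _ _ _)
      rw [parityRevDecompose, e0, e1, map_add, map_add, parityRevDecompose, parityRevDecompose]
      abel

/-- A linear map is homogeneous of parity `p`. -/
def HasParity {k X Y : Type*} [Semiring k] [AddCommMonoid X] [Module k X] [AddCommMonoid Y]
    [Module k Y] (𝒳 : ZMod 2 → Submodule k X) (𝒴 : ZMod 2 → Submodule k Y) (p : ZMod 2)
    (f : X →ₗ[k] Y) : Prop :=
  ∀ i, ∀ x ∈ 𝒳 i, f x ∈ 𝒴 (i + p)

end Graded

/-! ### The symmetric coalgebra -/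

section Symmetric

variable {k : Type*} [CommRing k] {W : Type*} [AddCommGroup W] [Module k W]

/-- The relations `u ⊗ v = (-1)^(uv) v ⊗ u` for homogeneous `u`, `v`. -/
inductive SymRel (𝒲 : ZMod 2 → Submodule k W) : TensorAlgebra k W → TensorAlgebra k W → Prop
  | comm (i j : ZMod 2) (u v : W) (hu : u ∈ 𝒲 i) (hv : v ∈ 𝒲 j) :
      SymRel 𝒲 (TensorAlgebra.ι k u * TensorAlgebra.ι k v)
        (sgn k i j • (TensorAlgebra.ι k v * TensorAlgebra.ι k u))

/-- The unital graded symmetric algebra `k ⊕ W ⊕ W ⊙ W ⊕ ⋯`; its product is `⊙`. -/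
def SymAlg (𝒲 : ZMod 2 → Submodule k W) : Type _ := RingQuot (SymRel 𝒲)

instance (𝒲 : ZMod 2 → Submodule k W) : Ring (SymAlg 𝒲) :=
  inferInstanceAs (Ring (RingQuot (SymRel 𝒲)))

instance (𝒲 : ZMod 2 → Submodule k W) : Algebra k (SymAlg 𝒲) :=
  inferInstanceAs (Algebra k (RingQuot (SymRel 𝒲)))

/-- The quotient map from the tensor algebra. -/
def mkSym (𝒲 : ZMod 2 → Submodule k W) : TensorAlgebra k W →ₐ[k] SymAlg 𝒲 :=
  RingQuot.mkAlgHom k (SymRel 𝒲)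

variable (𝒲 : ZMod 2 → Submodule k W)

/-- The inclusion of `W` in the symmetric algebra. -/
def ι : W →ₗ[k] SymAlg 𝒲 :=
  (mkSym 𝒲).toLinearMap ∘ₗ TensorAlgebra.ι k

variable {𝒲} in
theorem ι_comm {i j : ZMod 2} {u v : W} (hu : u ∈ 𝒲 i) (hv : v ∈ 𝒲 j) :
    ι 𝒲 u * ι 𝒲 v = sgn k i j • (ι 𝒲 v * ι 𝒲 u) := by
  have h : mkSym 𝒲 _ = mkSym 𝒲 _ :=
    RingQuot.mkAlgHom_rel k (SymRel.comm (𝒲 := 𝒲) i j u v hu hv)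
  rw [map_mul, map_smul, map_mul] at h
  exact h

/-- The universal property of the symmetric algebra. -/
def lift {A : Type*} [Ring A] [Algebra k A] (f : W →ₗ[k] A)
    (hf : ∀ i j : ZMod 2, ∀ u ∈ 𝒲 i, ∀ v ∈ 𝒲 j, f u * f v = sgn k i j • (f v * f u)) :
    SymAlg 𝒲 →ₐ[k] A :=
  RingQuot.liftAlgHom k ⟨TensorAlgebra.lift k f, by
    rintro _ _ ⟨i, j, u, v, hu, hv⟩
    simpa using hf i j u hu v hv⟩

theorem lift_ι {A : Type*} [Ring A] [Algebra k A] (f : W →ₗ[k] A)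
    (hf : ∀ i j : ZMod 2, ∀ u ∈ 𝒲 i, ∀ v ∈ 𝒲 j, f u * f v = sgn k i j • (f v * f u)) (w : W) :
    lift 𝒲 f hf (ι 𝒲 w) = f w := by
  have h := RingQuot.liftAlgHom_mkAlgHom_apply k (TensorAlgebra.lift k f)
    (s := SymRel 𝒲) (by
      rintro _ _ ⟨i, j, u, v, hu, hv⟩
      simpa using hf i j u hu v hv) (TensorAlgebra.ι k w)
  rw [TensorAlgebra.lift_ι_apply] at h
  exact h

/-- The augmentation `⊙W → k`, which kills `W`. -/
def aug : SymAlg 𝒲 →ₐ[k] k := lift 𝒲 0 (by simp)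

/-- The (reduced) symmetric coalgebra `⊙W = ⨁_{n ≥ 1} ⊙ⁿ W`, as the augmentation ideal of the
unital symmetric algebra. -/
def Sym : Type _ := LinearMap.ker (aug 𝒲).toLinearMap

instance : AddCommGroup (Sym 𝒲) :=
  inferInstanceAs (AddCommGroup (LinearMap.ker (aug 𝒲).toLinearMap))

instance : Module k (Sym 𝒲) :=
  inferInstanceAs (Module k (LinearMap.ker (aug 𝒲).toLinearMap))

/-- The inclusion of `⊙W` in the unital symmetric algebra. -/
def incl : Sym 𝒲 →ₗ[k] SymAlg 𝒲 := (LinearMap.ker (aug 𝒲).toLinearMap).subtype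

/-- The projection of the unital symmetric algebra to `⊙W`, with kernel `k`. -/
def toSym : SymAlg 𝒲 →ₗ[k] Sym 𝒲 :=
  (LinearMap.id - Algebra.linearMap k (SymAlg 𝒲) ∘ₗ (aug 𝒲).toLinearMap).codRestrict
    (LinearMap.ker (aug 𝒲).toLinearMap) (fun x => by simp)

theorem incl_toSym (x : SymAlg 𝒲) :
    incl 𝒲 (toSym 𝒲 x) = x - algebraMap k (SymAlg 𝒲) (aug 𝒲 x) := rfl

theorem toSym_incl (x : Sym 𝒲) : toSym 𝒲 (incl 𝒲 x) = x := by
  have h : aug 𝒲 (incl 𝒲 x) = 0 := x.2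
  apply Subtype.ext
  change incl 𝒲 (toSym 𝒲 (incl 𝒲 x)) = incl 𝒲 x
  rw [incl_toSym, h, map_zero, sub_zero]

/-- The elements of parity `i` of `⊙W`: the span of the products `v₁ ⊙ ⋯ ⊙ vₙ` of homogeneous
elements whose parities add up to `i`. -/
def symGrading (i : ZMod 2) : Submodule k (Sym 𝒲) :=
  (Submodule.span k {x : SymAlg 𝒲 | ∃ (n : ℕ) (p : Fin n → ZMod 2) (v : Fin n → W),
    (∀ j, v j ∈ 𝒲 (p j)) ∧ ∑ j, p j = i ∧ x = (List.ofFn fun j => ι 𝒲 (v j)).prod}).comap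
    (incl 𝒲)

/-- The representation of the symmetric algebra on `k ⊕ W` in which `w ∈ W` acts by
`(c, x) ↦ (0, c w)`. -/
def degreeOneRep : SymAlg 𝒲 →ₐ[k] Module.End k (k × W) :=
  lift 𝒲
    { toFun := fun w => LinearMap.inr k k W ∘ₗ (LinearMap.fst k k W).smulRight w
      map_add' := fun a b => by ext <;> simp
      map_smul' := fun c a => by ext <;> simp }
    (fun i j u _ v _ => by ext <;> simp)

/-- The projection `⊙W → W` to the component of degree one: the products `v₁ ⊙ ⋯ ⊙ vₙ` with
`n ≥ 2` act by zero in `degreeOneRep`, and `w ∈ W` sends `(1, 0)` to `(0, w)`. -/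
def toW : Sym 𝒲 →ₗ[k] W :=
  LinearMap.snd k k W ∘ₗ LinearMap.applyₗ ((1, 0) : k × W) ∘ₗ
    (degreeOneRep 𝒲).toLinearMap ∘ₗ incl 𝒲

theorem toW_apply (x : Sym 𝒲) : toW 𝒲 x = (degreeOneRep 𝒲 (incl 𝒲 x) (1, 0)).2 := rfl

variable [DirectSum.Decomposition 𝒲]

theorem sign_W {i : ZMod 2} {u : W} (hu : u ∈ 𝒲 i) :
    proj 𝒲 0 u - proj 𝒲 1 u = sgn k i 1 • u := by
  rcases zmod_two_cases i with rfl | rfl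
  · rw [proj_same 𝒲 hu, proj_ne 𝒲 hu (by decide)]
    simp [sgn]
  · rw [proj_same 𝒲 hu, proj_ne 𝒲 hu (by decide)]
    simp [sgn, ZMod.val_one]

/-- The parity automorphism `x ↦ (-1)^x x` of the symmetric algebra. -/
def parityAut : SymAlg 𝒲 →ₐ[k] SymAlg 𝒲 :=
  lift 𝒲 (ι 𝒲 ∘ₗ (proj 𝒲 0 - proj 𝒲 1)) (fun i j u hu v hv => by
    simp only [LinearMap.comp_apply, LinearMap.sub_apply, sign_W 𝒲 hu, sign_W 𝒲 hv, map_smul,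
      smul_mul_smul_comm, ι_comm hu hv]
    simp only [smul_smul]
    congr 1
    ring)

/-- The parity automorphism `x ↦ (-1)^x x` of `⊙W`. -/
def symSign : Module.End k (Sym 𝒲) :=
  toSym 𝒲 ∘ₗ (parityAut 𝒲).toLinearMap ∘ₗ incl 𝒲

/-- Left multiplication by `w ⊗ 1 + 1 ⊗ w` on the graded tensor product of two copies of the
symmetric algebra: `a ⊗ b ↦ w a ⊗ b + (-1)^(w a) a ⊗ w b`. -/
def mulPrim : W →ₗ[k] Module.End k (SymAlg 𝒲 ⊗[k] SymAlg 𝒲) :=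
  (TensorProduct.mapBilinear (.id k) (SymAlg 𝒲) (SymAlg 𝒲) (SymAlg 𝒲) (SymAlg 𝒲)).flip
      LinearMap.id ∘ₗ LinearMap.mul k (SymAlg 𝒲) ∘ₗ ι 𝒲 +
    TensorProduct.mapBilinear (.id k) (SymAlg 𝒲) (SymAlg 𝒲) (SymAlg 𝒲) (SymAlg 𝒲)
      LinearMap.id ∘ₗ LinearMap.mul k (SymAlg 𝒲) ∘ₗ ι 𝒲 ∘ₗ proj 𝒲 0 +
    TensorProduct.mapBilinear (.id k) (SymAlg 𝒲) (SymAlg 𝒲) (SymAlg 𝒲) (SymAlg 𝒲)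
      (parityAut 𝒲).toLinearMap ∘ₗ LinearMap.mul k (SymAlg 𝒲) ∘ₗ ι 𝒲 ∘ₗ proj 𝒲 1

theorem mulPrim_tmul (w : W) (a b : SymAlg 𝒲) :
    mulPrim 𝒲 w (a ⊗ₜ b) = (ι 𝒲 w * a) ⊗ₜ b + a ⊗ₜ (ι 𝒲 (proj 𝒲 0 w) * b) +
      parityAut 𝒲 a ⊗ₜ (ι 𝒲 (proj 𝒲 1 w) * b) := by
  simp [mulPrim]

/-- For `w` of parity `i`, the operator `mulPrim w` is `a ⊗ b ↦ w a ⊗ b + (-1)^(i a) a ⊗ w b`. -/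
theorem mulPrim_tmul_of_mem {i : ZMod 2} {w : W} (hw : w ∈ 𝒲 i) (a b : SymAlg 𝒲) :
    mulPrim 𝒲 w (a ⊗ₜ b) =
      (ι 𝒲 w * a) ⊗ₜ b + ((parityAut 𝒲).toLinearMap ^ i.val) a ⊗ₜ (ι 𝒲 w * b) := by
  rcases zmod_two_cases i with rfl | rfl
  · simp [mulPrim_tmul, proj_same 𝒲 hw, proj_ne 𝒲 hw (show (0 : ZMod 2) ≠ 1 by decide)]
  · simp [mulPrim_tmul, proj_same 𝒲 hw, proj_ne 𝒲 hw (show (1 : ZMod 2) ≠ 0 by decide),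
      ZMod.val_one]

theorem parityAut_ι {i : ZMod 2} {w : W} (hw : w ∈ 𝒲 i) :
    parityAut 𝒲 (ι 𝒲 w) = sgn k i 1 • ι 𝒲 w := by
  rw [parityAut, lift_ι, LinearMap.comp_apply, LinearMap.sub_apply, sign_W 𝒲 hw, map_smul]

theorem mulPrim_comm (i j : ZMod 2) (u : W) (hu : u ∈ 𝒲 i) (v : W) (hv : v ∈ 𝒲 j) :
    mulPrim 𝒲 u * mulPrim 𝒲 v = sgn k i j • (mulPrim 𝒲 v * mulPrim 𝒲 u) := by
  ext a b
  have h : ι 𝒲 u * ι 𝒲 v = sgn k i j • (ι 𝒲 v * ι 𝒲 u) := ι_comm hu hv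
  have hb := congrArg (· * b) h
  have ha := congrArg (· * a) h
  simp only [mul_assoc, smul_mul_assoc] at ha hb
  have hpu := parityAut_ι 𝒲 hu
  have hpv := parityAut_ι 𝒲 hv
  simp only [TensorProduct.AlgebraTensorModule.curry_apply, LinearMap.restrictScalars_self,
    TensorProduct.curry_apply, Module.End.mul_apply, LinearMap.smul_apply,
    mulPrim_tmul_of_mem 𝒲 hu, mulPrim_tmul_of_mem 𝒲 hv, map_add]
  rcases zmod_two_cases i with rfl | rfl <;> rcases zmod_two_cases j with rfl | rfl <;>
  · simp [sgn, ZMod.val_one] at ha hb hpu hpv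
    simp [sgn, ZMod.val_one, hpu, hpv, ha, hb, TensorProduct.tmul_neg, TensorProduct.neg_tmul]
    abel

/-- The full diagonal of the unital symmetric algebra: the multiplicative map to the graded tensor
product with `w ↦ w ⊗ 1 + 1 ⊗ w`. It sends `v₁ ⊙ ⋯ ⊙ vₙ` to the sum over `0 ≤ p ≤ n` and over
the unshuffles `σ` of type `(p, n - p)` of
`ε(σ) v_σ(1) ⊙ ⋯ ⊙ v_σ(p) ⊗ v_σ(p+1) ⊙ ⋯ ⊙ v_σ(n)`. -/
def fullDiagonal : SymAlg 𝒲 →ₗ[k] SymAlg 𝒲 ⊗[k] SymAlg 𝒲 :=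
  LinearMap.applyₗ ((1 : SymAlg 𝒲) ⊗ₜ[k] (1 : SymAlg 𝒲)) ∘ₗ (lift 𝒲 (mulPrim 𝒲) (mulPrim_comm 𝒲)).toLinearMap

theorem fullDiagonal_one : fullDiagonal 𝒲 1 = 1 ⊗ₜ 1 := by
  simp [fullDiagonal]

theorem fullDiagonal_ι_mul (w : W) (x : SymAlg 𝒲) :
    fullDiagonal 𝒲 (ι 𝒲 w * x) = mulPrim 𝒲 w (fullDiagonal 𝒲 x) := by
  simp [fullDiagonal, lift_ι]

/-- The reduced diagonal of the symmetric coalgebra `⊙W`: the terms `1 ≤ p ≤ n - 1` of the full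
diagonal. -/
def diagonal : Sym 𝒲 →ₗ[k] Sym 𝒲 ⊗[k] Sym 𝒲 :=
  TensorProduct.map (toSym 𝒲) (toSym 𝒲) ∘ₗ fullDiagonal 𝒲 ∘ₗ incl 𝒲

/-- A coderivation of parity `p` of `⊙W` with respect to the `ℤ₂`-grading: a homogeneous map with
`Δ ∘ F = (F ⊗ 1 + 1 ⊗ F) ∘ Δ`, where `(1 ⊗ F)(a ⊗ b) = (-1)^(a p) a ⊗ F b`. -/
structure IsCoderivation (p : ZMod 2) (F : Sym 𝒲 →ₗ[k] Sym 𝒲) : Prop where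
  parity : HasParity (symGrading 𝒲) (symGrading 𝒲) p F
  diagonal_comp : diagonal 𝒲 ∘ₗ F =
    (TensorProduct.map F LinearMap.id + TensorProduct.map (symSign 𝒲 ^ p.val) F) ∘ₗ diagonal 𝒲

/-! ### Cochains -/

/-- The cochains `C(W) = Hom(⊙W, W)`. -/
abbrev Cochain : Type _ := Sym 𝒲 →ₗ[k] W

/-- The submodule `C(W)_p` of the cochains of parity `p`. -/
def cochains (p : ZMod 2) : Submodule k (Cochain 𝒲) where
  carrier := {φ | HasParity (symGrading 𝒲) 𝒲 p φ}
  add_mem' hφ hψ i x hx := add_mem (hφ i x hx) (hψ i x hx)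
  zero_mem' _ _ _ := zero_mem _
  smul_mem' c _ hφ i x hx := (𝒲 (i + p)).smul_mem c (hφ i x hx)

/-- The extension `φ̂` of a cochain `φ` to `⊙W`: it sends `v₁ ⊙ ⋯ ⊙ vₙ` to the sum over
`1 ≤ p ≤ n` and over the unshuffles `σ` of type `(p, n - p)` of
`ε(σ) φ(v_σ(1) ⊙ ⋯ ⊙ v_σ(p)) ⊙ v_σ(p+1) ⊙ ⋯ ⊙ v_σ(n)`. -/
def extend : Cochain 𝒲 →ₗ[k] Sym 𝒲 →ₗ[k] Sym 𝒲 where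
  toFun φ := toSym 𝒲 ∘ₗ LinearMap.mul' k (SymAlg 𝒲) ∘ₗ
    TensorProduct.map (ι 𝒲 ∘ₗ φ ∘ₗ toSym 𝒲) LinearMap.id ∘ₗ fullDiagonal 𝒲 ∘ₗ incl 𝒲
  map_add' φ ψ := by
    simp only [LinearMap.add_comp, LinearMap.comp_add, TensorProduct.map_add_left]
  map_smul' c φ := by
    simp only [LinearMap.smul_comp, LinearMap.comp_smul, TensorProduct.map_smul_left,
      RingHom.id_apply]

/-- The bracket `[φ, ψ] = φ ∘ ψ̂ - (-1)^(pq) ψ ∘ φ̂` of cochains of parities `p` and `q`, which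
is the bracket of the coderivations `φ̂` and `ψ̂`. -/
def bracket (p q : ZMod 2) (φ ψ : Cochain 𝒲) : Cochain 𝒲 :=
  φ ∘ₗ extend 𝒲 ψ - sgn k p q • (ψ ∘ₗ extend 𝒲 φ)

end Symmetric

/-! ### `L∞` algebras and their cohomology -/

section Cohomology

variable {k : Type*} [CommRing k] {V : Type*} [AddCommGroup V] [Module k V]

/-- An `L∞` algebra structure on `V`: an odd codifferential on the symmetric coalgebra of `ΠV`. -/
structure LInfinityStructure (𝒱 : ZMod 2 → Submodule k V) [DirectSum.Decomposition 𝒱] where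
  /-- The codifferential. -/
  d : Sym (parityRev 𝒱) →ₗ[k] Sym (parityRev 𝒱)
  isCoderivation : IsCoderivation (parityRev 𝒱) 1 d
  comp_self : d ∘ₗ d = 0

variable {𝒱 : ZMod 2 → Submodule k V} [DirectSum.Decomposition 𝒱] (L : LInfinityStructure 𝒱)

namespace LInfinityStructure

/-- The cochain `l : ⊙ΠV → ΠV` that is induced by the codifferential; its restrictions to the
`⊙ⁿΠV` are the structure maps of the `L∞` algebra. -/
def l : Cochain (parityRev 𝒱) := toW (parityRev 𝒱) ∘ₗ L.d

/-- The coboundary `D(φ) = [φ, l]` of the cochains `φ` of parity `p`. -/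
def D (p : ZMod 2) : Cochain (parityRev 𝒱) →ₗ[k] Cochain (parityRev 𝒱) where
  toFun φ := bracket (parityRev 𝒱) p 1 φ L.l
  map_add' φ ψ := by
    simp only [bracket, map_add, LinearMap.add_comp, LinearMap.comp_add, smul_add]
    abel
  map_smul' c φ := by
    simp only [bracket, map_smul, LinearMap.smul_comp, LinearMap.comp_smul, smul_sub,
      RingHom.id_apply, smul_comm c]

/-- The cocycles of parity `p`. -/
def cocycles (p : ZMod 2) : Submodule k (Cochain (parityRev 𝒱)) :=
  cochains (parityRev 𝒱) p ⊓ LinearMap.ker (L.D p)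

/-- The coboundaries of parity `p`: the `D(φ)` with `φ` of parity `p + 1`. -/
def coboundaries (p : ZMod 2) : Submodule k (Cochain (parityRev 𝒱)) :=
  (cochains (parityRev 𝒱) (p + 1)).map (L.D (p + 1))

/-- The part of parity `p` of the cohomology `H(V)`. -/
abbrev H (p : ZMod 2) : Type _ := L.cocycles p ⧸ (L.coboundaries p).submoduleOf (L.cocycles p)

end LInfinityStructure

end Cohomology

/-! ### Infinitesimal deformations

`t` is a parameter of parity `s` with `t² = 0` and `x t = (-1)^(s x) t x`. An element `a + t b` of
`X[t] = X ⊕ t X` is written as the pair `(a, b)`. -/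

section Deformation

variable {k : Type*} [CommRing k] {W : Type*} [AddCommGroup W] [Module k W]

/-- Multiplication by `t` on `X[t]`: `t (a + t b) = t a`. -/
def tMul (k X : Type*) [CommRing k] [AddCommMonoid X] [Module k X] : X × X →ₗ[k] X × X :=
  LinearMap.inr k X X ∘ₗ LinearMap.fst k X X

/-- The grading of `X[t]`, for `t` of parity `s`: the parity of `t b` is that of `b` plus `s`. -/
def tGrading {X : Type*} [AddCommMonoid X] [Module k X] (s : ZMod 2) (𝒳 : ZMod 2 → Submodule k X)
    (i : ZMod 2) : Submodule k (X × X) :=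
  (𝒳 i).prod (𝒳 (i + s))

/-- The operator `f + t g` on `X[t]`, for `f` odd and `t` of parity `s`:
`(f + t g)(a + t b) = f a + t (g a + (-1)^s f b)`. -/
def tOdd {X : Type*} [AddCommMonoid X] [Module k X] (s : ZMod 2) (f g : X →ₗ[k] X) :
    X × X →ₗ[k] X × X :=
  (f ∘ₗ LinearMap.fst k X X).prod
    (g ∘ₗ LinearMap.fst k X X + sgn k s 1 • (f ∘ₗ LinearMap.snd k X X))

variable (𝒲 : ZMod 2 → Submodule k W) [DirectSum.Decomposition 𝒲]

/-- The coalgebra `⊙W[t]` over `k[t]`. -/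
abbrev SymT : Type _ := Sym 𝒲 × Sym 𝒲

/-- `⊙W[t] ⊗_{k[t]} ⊙W[t]`, identified with `(⊙W ⊗ ⊙W)[t]`. -/
abbrev SymTensorT : Type _ := (Sym 𝒲 ⊗[k] Sym 𝒲) × (Sym 𝒲 ⊗[k] Sym 𝒲)

/-- The diagonal of `⊙W[t]`, which extends the diagonal of `⊙W` linearly over `k[t]`. -/
def diagonalT : SymT 𝒲 →ₗ[k] SymTensorT 𝒲 :=
  (diagonal 𝒲).prodMap (diagonal 𝒲)

/-- The product `x, y ↦ x ⊗ y` of elements of `⊙W[t]`, for `t` of parity `s`: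
`(a + t b) ⊗ (a' + t b') = a ⊗ a' + t (b ⊗ a' + (-1)^(s a) a ⊗ b')`. -/
def tmulT (s : ZMod 2) : SymT 𝒲 →ₗ[k] SymT 𝒲 →ₗ[k] SymTensorT 𝒲 :=
  LinearMap.mk₂ k
    (fun x y => (x.1 ⊗ₜ[k] y.1, x.2 ⊗ₜ[k] y.1 + (symSign 𝒲 ^ s.val) x.1 ⊗ₜ[k] y.2))
    (fun x x' y => by
      ext1
      · simp [TensorProduct.add_tmul]
      · simp only [Prod.fst_add, Prod.snd_add, map_add, TensorProduct.add_tmul]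
        abel)
    (fun c x y => by
      ext1
      · simp [TensorProduct.smul_tmul']
      · simp [TensorProduct.smul_tmul'])
    (fun x y y' => by
      ext1
      · simp [TensorProduct.tmul_add]
      · simp only [Prod.fst_add, Prod.snd_add, TensorProduct.tmul_add]
        abel)
    (fun c x y => by
      ext1
      · simp
      · simp)

/-- `F ⊗ G : ⊙W ⊗ ⊙W → ⊙W[t] ⊗_{k[t]} ⊙W[t]`, `a ⊗ b ↦ F(a) ⊗ G(b)`, with no sign. -/
def mapT (s : ZMod 2) (F G : SymT 𝒲 →ₗ[k] SymT 𝒲) : Sym 𝒲 ⊗[k] Sym 𝒲 →ₗ[k] SymTensorT 𝒲 :=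
  TensorProduct.lift ((tmulT 𝒲 s).compl₁₂ (F ∘ₗ LinearMap.inl k _ _) (G ∘ₗ LinearMap.inl k _ _))

/-- The parity automorphism `x ↦ (-1)^x x` of `⊙W[t]`, for `t` of parity `s`. -/
def signT (s : ZMod 2) : SymT 𝒲 →ₗ[k] SymT 𝒲 :=
  (symSign 𝒲).prodMap (sgn k s 1 • symSign 𝒲)

/-- An odd codifferential on the coalgebra `⊙W[t]` over `k[t]`, where `t` has parity `s`. By
linearity over `k[t]` the coderivation property is the one on the elements `(a, 0)` of `⊙W`. -/
structure IsOddCodifferentialT (s : ZMod 2) (F : SymT 𝒲 →ₗ[k] SymT 𝒲) : Prop where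
  parity : HasParity (tGrading s (symGrading 𝒲)) (tGrading s (symGrading 𝒲)) 1 F
  map_tMul : ∀ x, F (tMul k (Sym 𝒲) x) = sgn k s 1 • tMul k (Sym 𝒲) (F x)
  diagonal_comp : ∀ a : Sym 𝒲, diagonalT 𝒲 (F (a, 0)) =
    (mapT 𝒲 s F LinearMap.id + mapT 𝒲 s (signT 𝒲 s) F)
      (diagonal 𝒲 a)
  comp_self : F ∘ₗ F = 0

/-- An (even) automorphism of the graded coalgebra `⊙W[t]` over `k[t]`, where `t` has
parity `s`. -/
structure IsAutomorphismT (s : ZMod 2) (Φ : SymT 𝒲 →ₗ[k] SymT 𝒲) : Prop where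
  parity : HasParity (tGrading s (symGrading 𝒲)) (tGrading s (symGrading 𝒲)) 0 Φ
  map_tMul : ∀ x, Φ (tMul k (Sym 𝒲) x) = tMul k (Sym 𝒲) (Φ x)
  diagonal_comp : ∀ a : Sym 𝒲, diagonalT 𝒲 (Φ (a, 0)) = mapT 𝒲 s Φ Φ (diagonal 𝒲 a)
  bijective : Function.Bijective Φ

end Deformation

namespace LInfinityStructure

variable {k : Type*} [CommRing k] {V : Type*} [AddCommGroup V] [Module k V]
  {𝒱 : ZMod 2 → Submodule k V} [DirectSum.Decomposition 𝒱] (L : LInfinityStructure 𝒱)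

/-- An infinitesimal deformation of an `L∞` algebra, with a parameter `t` of parity `s`: an odd
codifferential on `⊙ΠV[t]` over `k[t]` that reduces to `d` modulo `t`. -/
structure IsInfinitesimalDeformation (s : ZMod 2)
    (F : SymT (parityRev 𝒱) →ₗ[k] SymT (parityRev 𝒱)) : Prop where
  isOddCodifferentialT : IsOddCodifferentialT (parityRev 𝒱) s F
  reduction : ∀ a, (F (a, 0)).1 = L.d a

/-- The operator `d + t δ̂` on `⊙ΠV[t]` given by a cochain `δ`, for `t` of parity `s`. -/
def deform (s : ZMod 2) (δ : Cochain (parityRev 𝒱)) :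
    SymT (parityRev 𝒱) →ₗ[k] SymT (parityRev 𝒱) :=
  tOdd s L.d (extend (parityRev 𝒱) δ)

/-- `F` is trivial: an automorphism of the coalgebra `⊙ΠV[t]` takes `d` to `F`. -/
def IsTrivialDeformation (s : ZMod 2) (F : SymT (parityRev 𝒱) →ₗ[k] SymT (parityRev 𝒱)) : Prop :=
  ∃ Φ, IsAutomorphismT (parityRev 𝒱) s Φ ∧ Φ ∘ₗ L.deform s 0 = F ∘ₗ Φ

end LInfinityStructure

/-- Two infinitesimal deformations `F` and `F'` are equivalent: an automorphism of the coalgebra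
`⊙W[t]` which is the identity modulo `t` takes `F` to `F'`. -/
def EquivalentDeformations {k : Type*} [CommRing k] {W : Type*} [AddCommGroup W] [Module k W]
    (𝒲 : ZMod 2 → Submodule k W) [DirectSum.Decomposition 𝒲] (s : ZMod 2)
    (F F' : SymT 𝒲 →ₗ[k] SymT 𝒲) : Prop :=
  ∃ Φ, IsAutomorphismT 𝒲 s Φ ∧ (∀ a, (Φ (a, 0)).1 = a) ∧ Φ ∘ₗ F = F' ∘ₗ Φ

end

end LInfinity

/-! Coderivations of `⊙W` are the same as cochains. The extension of a cochain is a coderivation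
(`isCoderivation_extend`) whose degree-one component is the cochain itself (`toW_extend`), and a
coderivation with vanishing degree-one component is zero (`IsCoderivation.eq_zero`). For the last
point let `E = fullExtend (degreeOne 𝒲)` be the Euler operator, which multiplies degree `n` by `n`.
If `G` is such a coderivation, then `E (G y)` is a sum of terms `± u ⊙ G z` with `u` of degree one
and `z` one degree lower than `y`. Induction on the degree gives `E (G y) = 0`, hence `G y = 0`
because positive integers are invertible.

The graded commutator of a coderivation with an odd one is again a coderivation, so `D` is the
commutator with `d` read off in degree one (`D_apply`, `extend_D`), and `d² = 0` gives `D² = 0`.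

Everything over `k[t]` is then a comparison of coefficients of `t`. An operator `d + t f` is an odd
codifferential exactly when `f` is a coderivation of parity `s + 1` whose commutator with `d`
vanishes (`isOddCodifferentialT_tOdd_iff`), that is, when `f` extends a cocycle. An automorphism is
`φ₀ + t φ₁` with `φ₀` invertible and `φ₁ φ₀⁻¹` a coderivation of parity `s`
(`IsAutomorphismT.exists_isCoderivation`). If it takes `d` to `d + t δ̂`, then `φ₀` commutes with
`d` and `δ̂ = [φ₁ φ₀⁻¹, d]`, so `δ` is a coboundary. Conversely `1 + t λ̂` realizes `δ = D λ`. The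
same computation with `φ₀ = 1` shows that two deformations are equivalent exactly when their
cochains differ by a coboundary.

Signs are handled by describing parity through an involution with eigenvalues `±1`. This replaces
case distinctions on homogeneous elements by operator identities valid on all elements. -/

namespace LInfinity

noncomputable section

/-! ### Parity as an eigenvalue of a sign operator -/

section Sign

variable {k : Type*} [CommRing k]

theorem sgn_zero_left (i : ZMod 2) : sgn k 0 i = 1 := by simp [sgn]

theorem sgn_zero_right (i : ZMod 2) : sgn k i 0 = 1 := by simp [sgn]

theorem sgn_one_one : sgn k 1 1 = -1 := by simp [sgn, ZMod.val_one]

theorem sgn_add_one (p q : ZMod 2) : sgn k (p + q) 1 = sgn k p 1 * sgn k q 1 := by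
  rcases zmod_two_cases p with rfl | rfl <;> rcases zmod_two_cases q with rfl | rfl <;>
    simp [sgn_zero_left, sgn_one_one, show (1 + 1 : ZMod 2) = 0 from rfl]

theorem sgn_mul_self (p q : ZMod 2) : sgn k p q * sgn k p q = 1 := by
  rw [sgn, ← mul_pow]; simp

theorem add_self_cancel (p q : ZMod 2) : p + q + q = p := by
  revert p q; decide

theorem pow_val_add {X : Type*} [AddCommGroup X] [Module k X] {f : Module.End k X}
    (hf : f * f = 1) (p q : ZMod 2) : f ^ (p + q).val = f ^ p.val * f ^ q.val := by
  rcases zmod_two_cases p with rfl | rfl <;> rcases zmod_two_cases q with rfl | rfl <;>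
    simp [ZMod.val_one, show (1 + 1 : ZMod 2) = 0 from rfl, hf]

/-- The only point where rational scalars enter directly: with `n = 2` to separate the two parities,
and with arbitrary `n ≠ 0` to invert the Euler operator. -/
theorem natCast_smul_eq_zero [Algebra ℚ k] {X : Type*} [AddCommGroup X] [Module k X] {n : ℕ}
    (hn : n ≠ 0) {x : X} (h : (n : k) • x = 0) : x = 0 := by
  have e : algebraMap ℚ k (n : ℚ)⁻¹ * (n : k) = 1 := by
    rw [← map_natCast (algebraMap ℚ k), ← map_mul, inv_mul_cancel₀ (by exact_mod_cast hn), map_one]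
  rw [← one_smul k x, ← e, mul_smul, h, smul_zero]

/-- The grading `𝒳` is the one by the eigenspaces of the involution `f`. -/
structure IsSignOperator {X : Type*} [AddCommGroup X] [Module k X] (𝒳 : ZMod 2 → Submodule k X)
    (f : Module.End k X) : Prop where
  mul_self : f * f = 1
  mem_iff : ∀ i x, x ∈ 𝒳 i ↔ f x = sgn k i 1 • x

variable {X Y : Type*} [AddCommGroup X] [Module k X] [AddCommGroup Y] [Module k Y]
  {𝒳 : ZMod 2 → Submodule k X} {𝒴 : ZMod 2 → Submodule k Y} {f : Module.End k X}
  {g : Module.End k Y}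

theorem IsSignOperator.apply_apply (hf : IsSignOperator 𝒳 f) (x : X) : f (f x) = x :=
  LinearMap.congr_fun hf.mul_self x

/-- If `x = a + b` with `a` even and `b` odd, then `f x = a - b`; since 2 is invertible, `f x = ± x`
forces one of the two parts to vanish. -/
theorem isSignOperator_of_span [Algebra ℚ k] (h : ∀ i, ∀ x ∈ 𝒳 i, f x = sgn k i 1 • x)
    (hs : 𝒳 0 ⊔ 𝒳 1 = ⊤) : IsSignOperator 𝒳 f := by
  have key : ∀ x, ∃ a ∈ 𝒳 0, ∃ b ∈ 𝒳 1, x = a + b ∧ f x = a - b := fun x => by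
    obtain ⟨a, ha, b, hb, rfl⟩ := Submodule.mem_sup.1 (hs ▸ Submodule.mem_top : x ∈ 𝒳 0 ⊔ 𝒳 1)
    exact ⟨a, ha, b, hb, rfl, by
      rw [map_add, h 0 a ha, h 1 b hb, sgn_zero_left, sgn_one_one, one_smul, neg_one_smul,
        sub_eq_add_neg]⟩
  have two : ∀ y : X, y + y = 0 → y = 0 := fun y hy =>
    natCast_smul_eq_zero (k := k) two_ne_zero (by rw [Nat.cast_ofNat, two_smul, hy])
  refine ⟨LinearMap.ext fun x => ?_, fun i x => ⟨h i x, fun hx => ?_⟩⟩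
  · obtain ⟨a, ha, b, hb, rfl, hx⟩ := key x
    rw [Module.End.mul_apply, hx, map_sub, h 0 a ha, h 1 b hb, sgn_zero_left, sgn_one_one]
    simp
  · obtain ⟨a, ha, b, hb, rfl, hx'⟩ := key x
    rw [hx'] at hx
    rcases zmod_two_cases i with rfl | rfl
    · rw [sgn_zero_left, one_smul] at hx
      have : b = 0 := two b (by rw [← neg_eq_zero, ← sub_eq_zero.2 hx]; abel)
      rwa [this, add_zero]
    · rw [sgn_one_one, neg_one_smul] at hx
      have : a = 0 := two a (by rw [← sub_eq_zero.2 hx]; abel)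
      rwa [this, zero_add]

theorem hasParity_iff [Algebra ℚ k] (hf : IsSignOperator 𝒳 f) (hg : IsSignOperator 𝒴 g)
    {p : ZMod 2} {φ : X →ₗ[k] Y} :
    HasParity 𝒳 𝒴 p φ ↔ ∀ x, g (φ x) = sgn k p 1 • φ (f x) := by
  constructor
  · intro h x
    have hom : ∀ i, ∀ y ∈ 𝒳 i, g (φ y) = sgn k p 1 • φ (f y) := fun i y hy => by
      rw [(hg.mem_iff _ _).1 (h i y hy), (hf.mem_iff _ _).1 hy, map_smul, smul_smul, sgn_add_one,
        mul_comm]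
    have h0 : x + f x ∈ 𝒳 0 := by
      rw [hf.mem_iff, map_add, hf.apply_apply, sgn_zero_left, one_smul, add_comm]
    have h1 : x - f x ∈ 𝒳 1 := by
      rw [hf.mem_iff, map_sub, hf.apply_apply, sgn_one_one, neg_one_smul, neg_sub]
    have e0 := hom 0 _ h0
    have e1 := hom 1 _ h1
    simp only [map_add, map_sub, smul_add, smul_sub] at e0 e1
    -- Adding the identities for the even element `x + f x` and the odd element `x - f x` gives
    -- twice the claim.
    refine sub_eq_zero.1 (natCast_smul_eq_zero (k := k) two_ne_zero ?_)
    have e := congrArg₂ (· + ·) (sub_eq_zero.2 e0) (sub_eq_zero.2 e1)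
    simp only [add_zero] at e
    rw [Nat.cast_ofNat, two_smul, ← e]
    abel
  · intro h i x hx
    rw [hg.mem_iff, h, (hf.mem_iff _ _).1 hx, map_smul, smul_smul, sgn_add_one, mul_comm]

end Sign

/-! ### Sign operators of the symmetric coalgebra -/

section Parity

variable {k : Type*} [CommRing k] {W : Type*} [AddCommGroup W] [Module k W]
  (𝒲 : ZMod 2 → Submodule k W)

variable {𝒲} in
theorem SymAlg.induction_submodule (N : Submodule k (SymAlg 𝒲)) (one : 1 ∈ N)
    (mul : ∀ (w : W) (x : SymAlg 𝒲), x ∈ N → ι 𝒲 w * x ∈ N) (x : SymAlg 𝒲) : x ∈ N := by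
  obtain ⟨a, rfl⟩ : ∃ a, mkSym 𝒲 a = x := RingQuot.mkAlgHom_surjective k (SymRel 𝒲) x
  -- Stability of `N` under left multiplication by `a` is closed under products of such `a`, which
  -- membership of `a` itself is not.
  suffices h : ∀ y ∈ N, mkSym 𝒲 a * y ∈ N by simpa using h 1 one
  induction a using TensorAlgebra.induction with
  | algebraMap r =>
    intro y hy
    rw [AlgHom.commutes, ← Algebra.smul_def]
    exact N.smul_mem r hy
  | ι w => exact mul w
  | mul a b ha hb =>
    intro y hy
    rw [map_mul, mul_assoc]
    exact ha _ (hb _ hy)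
  | add a b ha hb =>
    intro y hy
    rw [map_add, add_mul]
    exact N.add_mem (ha y hy) (hb y hy)

variable {𝒲} in
theorem SymAlg.linearMap_ext {M : Type*} [AddCommGroup M] [Module k M] {f g : SymAlg 𝒲 →ₗ[k] M}
    (one : f 1 = g 1) (mul : ∀ (w : W) (x : SymAlg 𝒲), f x = g x → f (ι 𝒲 w * x) = g (ι 𝒲 w * x)) :
    f = g :=
  LinearMap.ext fun x => SymAlg.induction_submodule (LinearMap.eqLocus f g) one mul x

variable {𝒲} in
theorem SymAlg.algHom_ext {A : Type*} [Ring A] [Algebra k A] {f g : SymAlg 𝒲 →ₐ[k] A}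
    (h : ∀ w, f (ι 𝒲 w) = g (ι 𝒲 w)) : f = g := by
  refine AlgHom.toLinearMap_injective (SymAlg.linearMap_ext (by simp) fun w x hx => ?_)
  simp only [AlgHom.toLinearMap_apply, map_mul] at hx ⊢
  rw [hx, h]

theorem aug_ι (w : W) : aug 𝒲 (ι 𝒲 w) = 0 := lift_ι 𝒲 _ _ w

theorem aug_incl (x : Sym 𝒲) : aug 𝒲 (incl 𝒲 x) = 0 := x.2

theorem incl_injective : Function.Injective (incl 𝒲) := Subtype.val_injective

theorem toSym_one : toSym 𝒲 1 = 0 :=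
  incl_injective 𝒲 (by rw [incl_toSym, map_one, map_one, sub_self, map_zero])

theorem incl_toSym_of_aug {x : SymAlg 𝒲} (h : aug 𝒲 x = 0) : incl 𝒲 (toSym 𝒲 x) = x := by
  rw [incl_toSym, h, map_zero, sub_zero]

/-- The elements of parity `i` of the unital symmetric algebra. -/
def algGrading (i : ZMod 2) : Submodule k (SymAlg 𝒲) :=
  Submodule.span k {x : SymAlg 𝒲 | ∃ (n : ℕ) (p : Fin n → ZMod 2) (v : Fin n → W),
    (∀ j, v j ∈ 𝒲 (p j)) ∧ ∑ j, p j = i ∧ x = (List.ofFn fun j => ι 𝒲 (v j)).prod}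

theorem one_mem_algGrading : 1 ∈ algGrading 𝒲 0 :=
  Submodule.subset_span ⟨0, Fin.elim0, Fin.elim0, fun j => j.elim0, by simp, by simp⟩

theorem ι_mul_mem_algGrading {i j : ZMod 2} {w : W} (hw : w ∈ 𝒲 i) {x : SymAlg 𝒲}
    (hx : x ∈ algGrading 𝒲 j) : ι 𝒲 w * x ∈ algGrading 𝒲 (i + j) := by
  induction hx using Submodule.span_induction with
  | mem x hx =>
    obtain ⟨n, p, v, hv, rfl, rfl⟩ := hx
    refine Submodule.subset_span ⟨n + 1, Fin.cons i p, Fin.cons w v, fun j => ?_, ?_, ?_⟩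
    · refine Fin.cases ?_ (fun j => ?_) j
      · simpa using hw
      · simpa using hv j
    · simp [Fin.sum_univ_succ]
    · simp [List.ofFn_succ]
  | zero => simp
  | add x y _ _ hx hy => rw [mul_add]; exact Submodule.add_mem _ hx hy
  | smul c x _ hx => rw [mul_smul_comm]; exact Submodule.smul_mem _ c hx

variable [DirectSum.Decomposition 𝒲]

/-- The parity automorphism `w ↦ (-1)^w w` of `W`. -/
def sign : Module.End k W := proj 𝒲 0 - proj 𝒲 1

theorem sign_of_mem {i : ZMod 2} {u : W} (hu : u ∈ 𝒲 i) : sign 𝒲 u = sgn k i 1 • u :=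
  sign_W 𝒲 hu

theorem isSignOperator_sign [Algebra ℚ k] : IsSignOperator 𝒲 (sign 𝒲) := by
  refine isSignOperator_of_span (fun i x hx => sign_of_mem 𝒲 hx) (eq_top_iff.2 fun x _ => ?_)
  rw [← proj_add_proj 𝒲 x]
  exact Submodule.add_mem_sup (proj_mem 𝒲 0 x) (proj_mem 𝒲 1 x)

variable {𝒲} in
theorem SymAlg.induction_homogeneous (N : Submodule k (SymAlg 𝒲)) (one : 1 ∈ N)
    (mul : ∀ (i : ZMod 2), ∀ w ∈ 𝒲 i, ∀ x ∈ N, ι 𝒲 w * x ∈ N) (x : SymAlg 𝒲) : x ∈ N := by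
  refine SymAlg.induction_submodule N one (fun w x hx => ?_) x
  rw [← proj_add_proj 𝒲 w, map_add, add_mul]
  exact N.add_mem (mul 0 _ (proj_mem 𝒲 0 w) x hx) (mul 1 _ (proj_mem 𝒲 1 w) x hx)

theorem parityAut_ι_eq (w : W) : parityAut 𝒲 (ι 𝒲 w) = ι 𝒲 (sign 𝒲 w) := lift_ι 𝒲 _ _ w

/-- The Koszul sign for an inhomogeneous `v`: it becomes a power of the sign operator applied to
`v`. -/
theorem ι_mul_ι {i : ZMod 2} {w : W} (hw : w ∈ 𝒲 i) (v : W) :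
    ι 𝒲 v * ι 𝒲 w = ι 𝒲 w * ι 𝒲 ((sign 𝒲 ^ i.val) v) := by
  rw [← proj_add_proj 𝒲 v]
  have h0 := proj_mem 𝒲 0 v
  have h1 := proj_mem 𝒲 1 v
  rcases zmod_two_cases i with rfl | rfl
  · simp [add_mul, mul_add, ι_comm h0 hw, ι_comm h1 hw, sgn_zero_right]
  · simp [add_mul, mul_add, ι_comm h0 hw, ι_comm h1 hw, sgn_zero_left, sgn_one_one, ZMod.val_one,
      sign_of_mem 𝒲 h0, sign_of_mem 𝒲 h1]

theorem parityAut_prod (n : ℕ) (p : Fin n → ZMod 2) (v : Fin n → W) (hv : ∀ j, v j ∈ 𝒲 (p j)) :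
    parityAut 𝒲 (List.ofFn fun j => ι 𝒲 (v j)).prod =
      sgn k (∑ j, p j) 1 • (List.ofFn fun j => ι 𝒲 (v j)).prod := by
  induction n with
  | zero => simp [sgn_zero_left]
  | succ n ih =>
    rw [List.ofFn_succ, List.prod_cons, map_mul, ih _ _ fun j => hv j.succ, parityAut_ι 𝒲 (hv 0),
      smul_mul_smul_comm, Fin.sum_univ_succ, sgn_add_one]

theorem isSignOperator_parityAut [Algebra ℚ k] :
    IsSignOperator (algGrading 𝒲) (parityAut 𝒲).toLinearMap := by
  refine isSignOperator_of_span (fun i x hx => ?_) (eq_top_iff.2 fun x _ => ?_)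
  · induction hx using Submodule.span_induction with
    | mem x hx =>
      obtain ⟨n, p, v, hv, rfl, rfl⟩ := hx
      exact parityAut_prod 𝒲 n p v hv
    | zero => simp
    | add x y _ _ hx hy => rw [map_add, smul_add, hx, hy]
    | smul c x _ hx => rw [map_smul, hx, smul_comm]
  · refine SymAlg.induction_homogeneous _ (Submodule.mem_sup_left (one_mem_algGrading 𝒲))
      (fun i w hw x hx => ?_) x
    obtain ⟨a, ha, b, hb, rfl⟩ := Submodule.mem_sup.1 hx
    have ha' := ι_mul_mem_algGrading 𝒲 hw ha
    have hb' := ι_mul_mem_algGrading 𝒲 hw hb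
    rw [mul_add]
    rcases zmod_two_cases i with rfl | rfl
    · exact Submodule.add_mem_sup ha' hb'
    · exact add_comm (ι 𝒲 w * b) _ ▸ Submodule.add_mem_sup hb' ha'

theorem aug_parityAut (x : SymAlg 𝒲) : aug 𝒲 (parityAut 𝒲 x) = aug 𝒲 x := by
  have h : (aug 𝒲).comp (parityAut 𝒲) = aug 𝒲 := SymAlg.algHom_ext fun w => by
    rw [AlgHom.comp_apply, parityAut_ι_eq, aug_ι, aug_ι]
  exact DFunLike.congr_fun h x

theorem incl_symSign (x : Sym 𝒲) : incl 𝒲 (symSign 𝒲 x) = parityAut 𝒲 (incl 𝒲 x) :=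
  incl_toSym_of_aug 𝒲 (by simp [aug_parityAut, aug_incl])

theorem toSym_parityAut (x : SymAlg 𝒲) : toSym 𝒲 (parityAut 𝒲 x) = symSign 𝒲 (toSym 𝒲 x) :=
  incl_injective 𝒲 (by simp [incl_symSign, incl_toSym, aug_parityAut])

theorem isSignOperator_symSign [Algebra ℚ k] : IsSignOperator (symGrading 𝒲) (symSign 𝒲) where
  mul_self := LinearMap.ext fun x => incl_injective 𝒲 (by
    rw [Module.End.mul_apply, incl_symSign, incl_symSign]
    exact (isSignOperator_parityAut 𝒲).apply_apply _)
  mem_iff i x := by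
    -- By definition `symGrading` is the preimage of `algGrading` under `incl`.
    refine ((isSignOperator_parityAut 𝒲).mem_iff i (incl 𝒲 x)).trans ?_
    rw [← (incl_injective 𝒲).eq_iff, incl_symSign, map_smul]
    rfl

end Parity

/-! ### Induction principles and the projections to degrees zero and one. -/

section Extension

variable {k : Type*} [CommRing k] {W : Type*} [AddCommGroup W] [Module k W]
  {𝒲 : ZMod 2 → Submodule k W}

theorem SymAlg.induction [DirectSum.Decomposition 𝒲] {C : SymAlg 𝒲 → Prop} (one : C 1)
    (add : ∀ x y, C x → C y → C (x + y)) (smul : ∀ (c : k) x, C x → C (c • x))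
    (mul : ∀ (i : ZMod 2), ∀ w ∈ 𝒲 i, ∀ x, C x → C (ι 𝒲 w * x)) (x : SymAlg 𝒲) : C x :=
  SymAlg.induction_homogeneous
    { carrier := {x | C x}
      add_mem' := fun {x y} hx hy => add x y hx hy
      zero_mem' := by simpa using smul 0 1 one
      smul_mem' := smul } one mul x

theorem SymAlg.linearMap_ext_prod {M : Type*} [AddCommGroup M] [Module k M] {f g : SymAlg 𝒲 →ₗ[k] M}
    (h : ∀ l : List W, f (l.map (ι 𝒲)).prod = g (l.map (ι 𝒲)).prod) : f = g := by
  have hs : ∀ x, x ∈ Submodule.span k (Set.range fun l : List W => (l.map (ι 𝒲)).prod) := by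
    refine SymAlg.induction_submodule _ (Submodule.subset_span ⟨[], by simp⟩) fun w x hx => ?_
    induction hx using Submodule.span_induction with
    | mem x hx =>
      obtain ⟨l, rfl⟩ := hx
      exact Submodule.subset_span ⟨w :: l, by simp⟩
    | zero => simp
    | add x y _ _ hx hy => rw [mul_add]; exact Submodule.add_mem _ hx hy
    | smul c x _ hx => rw [mul_smul_comm]; exact Submodule.smul_mem _ c hx
  refine LinearMap.ext fun x => ?_
  have hx := hs x
  induction hx using Submodule.span_induction with
  | mem x hx => obtain ⟨l, rfl⟩ := hx; exact h l
  | zero => simp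
  | add x y _ _ hx hy => rw [map_add, map_add, hx, hy]
  | smul c x _ hx => rw [map_smul, map_smul, hx]

variable (𝒲)

/-- The projection of the unital symmetric algebra to the component of degree one. -/
def degreeOne : SymAlg 𝒲 →ₗ[k] W := toW 𝒲 ∘ₗ toSym 𝒲

theorem degreeOneRep_ι (w : W) (x : k × W) : degreeOneRep 𝒲 (ι 𝒲 w) x = (0, x.1 • w) := by
  rw [degreeOneRep, lift_ι]; rfl

theorem degreeOneRep_fst (x : SymAlg 𝒲) : (degreeOneRep 𝒲 x (1, 0)).1 = aug 𝒲 x := by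
  have h : LinearMap.fst k k W ∘ₗ LinearMap.applyₗ ((1, 0) : k × W) ∘ₗ
      (degreeOneRep 𝒲).toLinearMap = (aug 𝒲).toLinearMap :=
    SymAlg.linearMap_ext (by simp) fun w x _ => by simp [degreeOneRep_ι, aug_ι]
  exact LinearMap.congr_fun h x

theorem degreeOne_apply (x : SymAlg 𝒲) : degreeOne 𝒲 x = (degreeOneRep 𝒲 x (1, 0)).2 := by
  rw [degreeOne, LinearMap.comp_apply, toW_apply, incl_toSym, map_sub, AlgHom.commutes]
  simp [Algebra.algebraMap_eq_smul_one]

theorem degreeOne_one : degreeOne 𝒲 1 = 0 := by simp [degreeOne_apply]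

theorem degreeOne_ι_mul (w : W) (x : SymAlg 𝒲) : degreeOne 𝒲 (ι 𝒲 w * x) = aug 𝒲 x • w := by
  rw [degreeOne_apply, map_mul, Module.End.mul_apply, degreeOneRep_ι, degreeOneRep_fst]

theorem degreeOne_incl (x : Sym 𝒲) : degreeOne 𝒲 (incl 𝒲 x) = toW 𝒲 x := by
  rw [degreeOne, LinearMap.comp_apply, toSym_incl]

/-! ### The counit -/

/-- The projection of the unital symmetric algebra to the component of degree zero. -/
def counit : SymAlg 𝒲 →ₗ[k] SymAlg 𝒲 := Algebra.linearMap k (SymAlg 𝒲) ∘ₗ (aug 𝒲).toLinearMap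

theorem counit_apply (x : SymAlg 𝒲) : counit 𝒲 x = aug 𝒲 x • 1 := by
  rw [counit, LinearMap.comp_apply, Algebra.linearMap_apply, Algebra.algebraMap_eq_smul_one,
    AlgHom.toLinearMap_apply]

variable [DirectSum.Decomposition 𝒲]

theorem degreeOne_parityAut (x : SymAlg 𝒲) :
    degreeOne 𝒲 (parityAut 𝒲 x) = sign 𝒲 (degreeOne 𝒲 x) := by
  have h : degreeOne 𝒲 ∘ₗ (parityAut 𝒲).toLinearMap = sign 𝒲 ∘ₗ degreeOne 𝒲 :=
    SymAlg.linearMap_ext (by simp [degreeOne_one]) fun w x _ => by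
      simp [degreeOne_ι_mul, parityAut_ι_eq, aug_parityAut]
  exact LinearMap.congr_fun h x

theorem aug_powParityAut (i : ℕ) (x : SymAlg 𝒲) :
    aug 𝒲 (((parityAut 𝒲).toLinearMap ^ i) x) = aug 𝒲 x := by
  induction i with
  | zero => simp
  | succ i ih => rw [pow_succ', Module.End.mul_apply, AlgHom.toLinearMap_apply, aug_parityAut, ih]

/-- A counit axiom: multiplying by `w ⊗ 1 + 1 ⊗ w` and then applying the augmentation on the left
leaves only the term in which `w` enters the second factor, because the augmentation kills `w`. -/
theorem map_counit_left (x : SymAlg 𝒲) :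
    TensorProduct.map (counit 𝒲) LinearMap.id (fullDiagonal 𝒲 x) = 1 ⊗ₜ x := by
  induction x using SymAlg.induction with
  | one => simp [fullDiagonal_one, counit_apply]
  | add x y hx hy => rw [map_add, map_add, hx, hy, TensorProduct.tmul_add]
  | smul c x hx => rw [map_smul, map_smul, hx, TensorProduct.tmul_smul]
  | mul i w hw x hx =>
    have h : ∀ z, TensorProduct.map (counit 𝒲) LinearMap.id (mulPrim 𝒲 w z) =
        TensorProduct.map LinearMap.id (LinearMap.mulLeft k (ι 𝒲 w))
          (TensorProduct.map (counit 𝒲) LinearMap.id z) := fun z => by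
      induction z using TensorProduct.induction_on with
      | zero => simp
      | add y z hy hz => simp only [map_add, hy, hz]
      | tmul a b =>
        simp [mulPrim_tmul_of_mem 𝒲 hw, counit_apply, aug_ι, aug_powParityAut]
    rw [fullDiagonal_ι_mul, h, hx]
    simp

theorem map_counit_right (x : SymAlg 𝒲) :
    TensorProduct.map LinearMap.id (counit 𝒲) (fullDiagonal 𝒲 x) = x ⊗ₜ 1 := by
  induction x using SymAlg.induction with
  | one => simp [fullDiagonal_one, counit_apply]
  | add x y hx hy => rw [map_add, map_add, hx, hy, TensorProduct.add_tmul]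
  | smul c x hx => rw [map_smul, map_smul, hx, TensorProduct.smul_tmul']
  | mul i w hw x hx =>
    have h : ∀ z, TensorProduct.map LinearMap.id (counit 𝒲) (mulPrim 𝒲 w z) =
        TensorProduct.map (LinearMap.mulLeft k (ι 𝒲 w)) LinearMap.id
          (TensorProduct.map LinearMap.id (counit 𝒲) z) := fun z => by
      induction z using TensorProduct.induction_on with
      | zero => simp
      | add y z hy hz => simp only [map_add, hy, hz]
      | tmul a b =>
        simp [mulPrim_tmul_of_mem 𝒲 hw, counit_apply, aug_ι]
    rw [fullDiagonal_ι_mul, h, hx]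
    simp

/-- Expand `(id - counit) ⊗ (id - counit)` and use both counit axioms; the fourth term vanishes
since the augmentation kills `y`. -/
theorem map_incl_diagonal (y : Sym 𝒲) :
    TensorProduct.map (incl 𝒲) (incl 𝒲) (diagonal 𝒲 y) =
      fullDiagonal 𝒲 (incl 𝒲 y) - 1 ⊗ₜ incl 𝒲 y - incl 𝒲 y ⊗ₜ 1 := by
  have h : ∀ z, TensorProduct.map (incl 𝒲) (incl 𝒲)
      (TensorProduct.map (toSym 𝒲) (toSym 𝒲) z) =
      z - TensorProduct.map (counit 𝒲) LinearMap.id z - TensorProduct.map LinearMap.id (counit 𝒲) z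
        + TensorProduct.map LinearMap.id (counit 𝒲)
          (TensorProduct.map (counit 𝒲) LinearMap.id z) := fun z => by
    induction z using TensorProduct.induction_on with
    | zero => simp
    | add y z hy hz => simp only [map_add, hy, hz]; abel
    | tmul a b =>
      simp only [TensorProduct.map_tmul, incl_toSym, TensorProduct.sub_tmul,
        TensorProduct.tmul_sub, counit_apply, Algebra.algebraMap_eq_smul_one, LinearMap.id_apply]
      abel
  rw [diagonal, LinearMap.comp_apply, LinearMap.comp_apply, h, map_counit_left, map_counit_right]
  simp [counit_apply, aug_incl]

/-! ### The extension of a cochain is a coderivation -/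

variable {𝒲}

/-- The extension `x ↦ Σ ψ(x₁) ⊙ x₂` of a linear map `ψ` to `W`, on the unital symmetric
algebra. -/
def fullExtend (ψ : SymAlg 𝒲 →ₗ[k] W) : SymAlg 𝒲 →ₗ[k] SymAlg 𝒲 :=
  LinearMap.mul' k (SymAlg 𝒲) ∘ₗ TensorProduct.map (ι 𝒲 ∘ₗ ψ) LinearMap.id ∘ₗ fullDiagonal 𝒲

theorem extend_apply (φ : Cochain 𝒲) (x : Sym 𝒲) :
    extend 𝒲 φ x = toSym 𝒲 (fullExtend (φ ∘ₗ toSym 𝒲) (incl 𝒲 x)) := rfl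

theorem fullExtend_one (ψ : SymAlg 𝒲 →ₗ[k] W) : fullExtend ψ 1 = ι 𝒲 (ψ 1) := by
  simp [fullExtend, fullDiagonal_one]

theorem aug_fullExtend (ψ : SymAlg 𝒲 →ₗ[k] W) (x : SymAlg 𝒲) : aug 𝒲 (fullExtend ψ x) = 0 := by
  rw [fullExtend, LinearMap.comp_apply, LinearMap.comp_apply]
  induction fullDiagonal 𝒲 x using TensorProduct.induction_on with
  | zero => simp
  | add y z hy hz => rw [map_add, map_add, map_add, hy, hz, add_zero]
  | tmul a b => simp [aug_ι]

/-- The degree-one part of `ψ(x₁) ⊙ x₂` sees only the degree-zero part of `x₂`, so the counit axiom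
collapses the sum to `ψ x`. -/
theorem degreeOne_fullExtend (ψ : SymAlg 𝒲 →ₗ[k] W) (x : SymAlg 𝒲) :
    degreeOne 𝒲 (fullExtend ψ x) = ψ x := by
  have h : ∀ z, degreeOne 𝒲 (LinearMap.mul' k (SymAlg 𝒲)
      (TensorProduct.map (ι 𝒲 ∘ₗ ψ) LinearMap.id z)) =
      degreeOne 𝒲 (LinearMap.mul' k (SymAlg 𝒲) (TensorProduct.map (ι 𝒲 ∘ₗ ψ) LinearMap.id
        (TensorProduct.map LinearMap.id (counit 𝒲) z))) := fun z => by
    induction z using TensorProduct.induction_on with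
    | zero => simp
    | add y z hy hz => simp only [map_add, hy, hz]
    | tmul a b =>
      simp only [TensorProduct.map_tmul, LinearMap.mul'_apply, LinearMap.comp_apply,
        LinearMap.id_apply, degreeOne_ι_mul, counit_apply, map_smul, map_one, smul_eq_mul, mul_one]
  rw [fullExtend, LinearMap.comp_apply, LinearMap.comp_apply, h, map_counit_right,
    TensorProduct.map_tmul, LinearMap.mul'_apply, LinearMap.comp_apply, degreeOne_ι_mul,
    LinearMap.id_apply, map_one, one_smul]

theorem toW_extend (φ : Cochain 𝒲) : toW 𝒲 ∘ₗ extend 𝒲 φ = φ := by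
  refine LinearMap.ext fun x => ?_
  rw [LinearMap.comp_apply, extend_apply]
  exact (degreeOne_fullExtend (φ ∘ₗ toSym 𝒲) (incl 𝒲 x)).trans (by simp [toSym_incl])

/-- A map from the symmetric algebra to `W` is homogeneous of parity `p`. -/
def SignParity (p : ZMod 2) (ψ : SymAlg 𝒲 →ₗ[k] W) : Prop :=
  ∀ x, sign 𝒲 (ψ x) = sgn k p 1 • ψ (parityAut 𝒲 x)

/-- Inductions on products replace `ψ` by `ψ(w ⊙ ·)`, which need not vanish at 1. This is why the
extension is studied for maps on the unital algebra. -/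
theorem SignParity.comp_mulLeft {p i : ZMod 2} {ψ : SymAlg 𝒲 →ₗ[k] W} (hψ : SignParity p ψ) {w : W}
    (hw : w ∈ 𝒲 i) : SignParity (p + i) (ψ ∘ₗ LinearMap.mulLeft k (ι 𝒲 w)) := fun x => by
  simp only [LinearMap.comp_apply, LinearMap.mulLeft_apply]
  rw [hψ, map_mul, parityAut_ι 𝒲 hw, smul_mul_assoc, map_smul, smul_smul, sgn_add_one]

theorem sgn_comm (p q : ZMod 2) : sgn k p q = sgn k q p := by
  rw [sgn, sgn, mul_comm]

theorem powParityAut_ι_mul (p : ZMod 2) {i : ZMod 2} {w : W} (hw : w ∈ 𝒲 i) (x : SymAlg 𝒲) :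
    ((parityAut 𝒲).toLinearMap ^ p.val) (ι 𝒲 w * x) =
      sgn k p i • (ι 𝒲 w * ((parityAut 𝒲).toLinearMap ^ p.val) x) := by
  rcases zmod_two_cases p with rfl | rfl
  · simp [sgn_zero_left]
  · simp [ZMod.val_one, parityAut_ι 𝒲 hw, sgn_comm 1 i]

theorem pow_symSign_toSym (p : ZMod 2) (x : SymAlg 𝒲) :
    (symSign 𝒲 ^ p.val) (toSym 𝒲 x) =
      toSym 𝒲 (((parityAut 𝒲).toLinearMap ^ p.val) x) := by
  rcases zmod_two_cases p with rfl | rfl <;> simp [ZMod.val_one, toSym_parityAut]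

variable [Algebra ℚ k]

theorem parityAut_parityAut (x : SymAlg 𝒲) : parityAut 𝒲 (parityAut 𝒲 x) = x :=
  (isSignOperator_parityAut 𝒲).apply_apply x

theorem SignParity.pow_sign {p : ZMod 2} {ψ : SymAlg 𝒲 →ₗ[k] W} (hψ : SignParity p ψ) (i : ZMod 2)
    (x : SymAlg 𝒲) :
    (sign 𝒲 ^ i.val) (ψ (((parityAut 𝒲).toLinearMap ^ i.val) x)) = sgn k p i • ψ x := by
  rcases zmod_two_cases i with rfl | rfl
  · simp [sgn_zero_right]
  · simp [ZMod.val_one, hψ _, parityAut_parityAut]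

/-- In each term of the diagonal the new factor `w` either joins the argument of `ψ` or stays
outside; in the second case moving it to the front past `ψ(x₁)` costs `(-1)^(pi)`. -/
theorem fullExtend_ι_mul {p i : ZMod 2} {ψ : SymAlg 𝒲 →ₗ[k] W} (hψ : SignParity p ψ) {w : W}
    (hw : w ∈ 𝒲 i) (x : SymAlg 𝒲) :
    fullExtend ψ (ι 𝒲 w * x) = fullExtend (ψ ∘ₗ LinearMap.mulLeft k (ι 𝒲 w)) x +
      sgn k p i • (ι 𝒲 w * fullExtend ψ x) := by
  simp only [fullExtend, LinearMap.comp_apply, fullDiagonal_ι_mul]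
  induction fullDiagonal 𝒲 x using TensorProduct.induction_on with
  | zero => simp
  | add y z hy hz =>
    simp only [map_add, hy, hz, mul_add, smul_add]
    abel
  | tmul a b =>
    rw [mulPrim_tmul_of_mem 𝒲 hw]
    simp only [map_add, TensorProduct.map_tmul, LinearMap.mul'_apply, LinearMap.comp_apply,
      LinearMap.id_apply, LinearMap.mulLeft_apply]
    rw [← mul_assoc (ι 𝒲 _) (ι 𝒲 w), ι_mul_ι 𝒲 hw, hψ.pow_sign, map_smul, mul_smul_comm,
      smul_mul_assoc, mul_assoc]

theorem parityAut_fullExtend {p : ZMod 2} {ψ : SymAlg 𝒲 →ₗ[k] W} (hψ : SignParity p ψ)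
    (x : SymAlg 𝒲) : parityAut 𝒲 (fullExtend ψ x) = sgn k p 1 • fullExtend ψ (parityAut 𝒲 x) := by
  induction x using SymAlg.induction generalizing p ψ with
  | one => rw [fullExtend_one, parityAut_ι_eq, hψ, map_one, fullExtend_one, map_smul]
  | add x y hx hy => simp only [map_add, smul_add, hx hψ, hy hψ]
  | smul c x hx => rw [map_smul, map_smul, map_smul, map_smul, hx hψ, smul_comm]
  | mul i w hw x hx =>
    rw [fullExtend_ι_mul hψ hw, map_add, hx (hψ.comp_mulLeft hw), map_smul, map_mul, hx hψ, map_mul,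
      parityAut_ι 𝒲 hw, smul_mul_assoc, smul_mul_assoc, map_smul (fullExtend ψ), fullExtend_ι_mul hψ hw, sgn_add_one]
    simp only [mul_smul_comm, smul_add, smul_smul]
    congr 2
    ring

theorem fullExtend_powParityAut {p : ZMod 2} {ψ : SymAlg 𝒲 →ₗ[k] W} (hψ : SignParity p ψ)
    (i : ZMod 2) (x : SymAlg 𝒲) :
    fullExtend ψ (((parityAut 𝒲).toLinearMap ^ i.val) x) =
      sgn k p i • ((parityAut 𝒲).toLinearMap ^ i.val) (fullExtend ψ x) := by
  rcases zmod_two_cases i with rfl | rfl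
  · simp [sgn_zero_right]
  · simp [ZMod.val_one, parityAut_fullExtend hψ, smul_smul, sgn_mul_self]

/-- Both sides satisfy the recursion of `fullExtend_ι_mul` under left multiplication by `w`, so the
induction must run over all `p` and `ψ` at once. It starts from the fact that `ψ 1`, as an element
of `W`, is primitive. -/
theorem fullDiagonal_fullExtend {p : ZMod 2} {ψ : SymAlg 𝒲 →ₗ[k] W} (hψ : SignParity p ψ)
    (x : SymAlg 𝒲) : fullDiagonal 𝒲 (fullExtend ψ x) =
      TensorProduct.map (fullExtend ψ) LinearMap.id (fullDiagonal 𝒲 x) +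
        TensorProduct.map ((parityAut 𝒲).toLinearMap ^ p.val) (fullExtend ψ)
          (fullDiagonal 𝒲 x) := by
  induction x using SymAlg.induction generalizing p ψ with
  | one =>
    have h1 : ((parityAut 𝒲).toLinearMap ^ p.val) 1 = 1 := by
      rcases zmod_two_cases p with rfl | rfl <;> simp [ZMod.val_one]
    have h2 : mulPrim 𝒲 (ψ 1) (1 ⊗ₜ 1) = ι 𝒲 (ψ 1) ⊗ₜ 1 + 1 ⊗ₜ ι 𝒲 (ψ 1) := by
      rw [mulPrim_tmul, map_one (parityAut 𝒲), mul_one, mul_one, mul_one, add_assoc, ← TensorProduct.tmul_add,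
        ← map_add, proj_add_proj]
    rw [fullExtend_one, ← mul_one (ι 𝒲 (ψ 1)), fullDiagonal_ι_mul, fullDiagonal_one, h2]
    simp [fullExtend_one, h1]
  | add x y hx hy =>
    simp only [map_add, hx hψ, hy hψ]
    abel
  | smul c x hx => simp only [map_smul, hx hψ, smul_add]
  | mul i w hw x hx =>
    have key : ∀ z, TensorProduct.map (fullExtend ψ) LinearMap.id (mulPrim 𝒲 w z) +
        TensorProduct.map ((parityAut 𝒲).toLinearMap ^ p.val) (fullExtend ψ) (mulPrim 𝒲 w z) =
        (TensorProduct.map (fullExtend (ψ ∘ₗ LinearMap.mulLeft k (ι 𝒲 w))) LinearMap.id z +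
          TensorProduct.map ((parityAut 𝒲).toLinearMap ^ (p + i).val)
            (fullExtend (ψ ∘ₗ LinearMap.mulLeft k (ι 𝒲 w))) z) +
        sgn k p i • mulPrim 𝒲 w (TensorProduct.map (fullExtend ψ) LinearMap.id z +
          TensorProduct.map ((parityAut 𝒲).toLinearMap ^ p.val) (fullExtend ψ) z) := fun z => by
      induction z using TensorProduct.induction_on with
      | zero => simp
      | add y z hy hz =>
        simp only [map_add, smul_add] at hy hz ⊢
        rw [add_add_add_comm, hy, hz]
        abel
      | tmul a b =>
        have hP : ∀ a, ((parityAut 𝒲).toLinearMap ^ p.val)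
            (((parityAut 𝒲).toLinearMap ^ i.val) a) =
            ((parityAut 𝒲).toLinearMap ^ (p + i).val) a := fun a => by
          rw [pow_val_add (isSignOperator_parityAut 𝒲).mul_self, Module.End.mul_apply]
        have hP' : ((parityAut 𝒲).toLinearMap ^ i.val)
            (((parityAut 𝒲).toLinearMap ^ p.val) a) =
            ((parityAut 𝒲).toLinearMap ^ (p + i).val) a := by
          rw [add_comm p i, pow_val_add (isSignOperator_parityAut 𝒲).mul_self,
            Module.End.mul_apply]
        simp only [map_add, TensorProduct.map_tmul, LinearMap.id_apply, mulPrim_tmul_of_mem 𝒲 hw,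
          fullExtend_ι_mul hψ hw, powParityAut_ι_mul p hw, fullExtend_powParityAut hψ, hP, hP',
          TensorProduct.add_tmul, TensorProduct.tmul_add, TensorProduct.smul_tmul',
          TensorProduct.tmul_smul, smul_add]
        abel
    rw [fullDiagonal_ι_mul, key, ← hx hψ, ← hx (hψ.comp_mulLeft hw), fullExtend_ι_mul hψ hw,
      map_add, map_smul, fullDiagonal_ι_mul]

theorem signParity_of_mem_cochains {p : ZMod 2} {φ : Cochain 𝒲} (hφ : φ ∈ cochains 𝒲 p) :
    SignParity p (φ ∘ₗ toSym 𝒲) := fun x => by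
  simp only [LinearMap.comp_apply, toSym_parityAut]
  exact (hasParity_iff (isSignOperator_symSign 𝒲) (isSignOperator_sign 𝒲)).1 hφ _

theorem isCoderivation_extend {p : ZMod 2} {φ : Cochain 𝒲} (hφ : φ ∈ cochains 𝒲 p) :
    IsCoderivation 𝒲 p (extend 𝒲 φ) := by
  have hψ := signParity_of_mem_cochains hφ
  -- The full extension descends to `⊙W` because `φ ∘ₗ toSym 𝒲` kills 1, so constants contribute
  -- nothing.
  have hext : ∀ x, extend 𝒲 φ (toSym 𝒲 x) = toSym 𝒲 (fullExtend (φ ∘ₗ toSym 𝒲) x) := fun x => by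
    rw [extend_apply, incl_toSym, map_sub, Algebra.algebraMap_eq_smul_one, map_smul, fullExtend_one,
      LinearMap.comp_apply, toSym_one, map_zero, map_zero, smul_zero, sub_zero]
  constructor
  · rw [hasParity_iff (isSignOperator_symSign 𝒲) (isSignOperator_symSign 𝒲)]
    intro x
    rw [extend_apply, extend_apply, ← toSym_parityAut, parityAut_fullExtend hψ, map_smul,
      incl_symSign]
  · refine LinearMap.ext fun x => ?_
    have h : ∀ z, TensorProduct.map (toSym 𝒲) (toSym 𝒲)
        (TensorProduct.map (fullExtend (φ ∘ₗ toSym 𝒲)) LinearMap.id z +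
          TensorProduct.map ((parityAut 𝒲).toLinearMap ^ p.val) (fullExtend (φ ∘ₗ toSym 𝒲)) z) =
        TensorProduct.map (extend 𝒲 φ) LinearMap.id (TensorProduct.map (toSym 𝒲) (toSym 𝒲) z) +
          TensorProduct.map (symSign 𝒲 ^ p.val) (extend 𝒲 φ)
            (TensorProduct.map (toSym 𝒲) (toSym 𝒲) z) := fun z => by
      induction z using TensorProduct.induction_on with
      | zero => simp
      | add y z hy hz =>
        simp only [map_add] at hy hz ⊢
        rw [add_add_add_comm, hy, hz]
        abel
      | tmul a b =>
        simp [hext, pow_symSign_toSym]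
    simp only [LinearMap.comp_apply, LinearMap.add_apply, diagonal]
    rw [← h, ← fullDiagonal_fullExtend hψ, extend_apply,
      incl_toSym_of_aug 𝒲 (aug_fullExtend _ _)]

end Extension

/-! ### Coderivations are determined by their degree-one component -/

section Uniqueness

variable {k : Type*} [CommRing k] {W : Type*} [AddCommGroup W] [Module k W]
  (𝒲 : ZMod 2 → Submodule k W)

/-- The homomorphism to polynomials that sends the products of `n` elements `w` of `W` to their
multiples by `X ^ n`. -/
def degreeHom : SymAlg 𝒲 →ₐ[k] Polynomial (SymAlg 𝒲) :=
  lift 𝒲 ((Polynomial.monomial 1).restrictScalars k ∘ₗ ι 𝒲) fun i j u hu v hv => by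
    simp only [LinearMap.comp_apply, LinearMap.restrictScalars_apply,
      Polynomial.monomial_mul_monomial, Polynomial.smul_monomial]
    rw [ι_comm hu hv]

theorem degreeHom_ι_mul (w : W) (x : SymAlg 𝒲) :
    degreeHom 𝒲 (ι 𝒲 w * x) = Polynomial.monomial 1 (ι 𝒲 w) * degreeHom 𝒲 x := by
  rw [map_mul, degreeHom, lift_ι]
  rfl

theorem coeff_zero_degreeHom_ι_mul (w : W) (x : SymAlg 𝒲) :
    (degreeHom 𝒲 (ι 𝒲 w * x)).coeff 0 = 0 := by
  rw [degreeHom_ι_mul, Polynomial.mul_coeff_zero, Polynomial.coeff_monomial_of_ne _ (by decide),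
    zero_mul]

theorem coeff_succ_degreeHom_ι_mul (w : W) (x : SymAlg 𝒲) (n : ℕ) :
    (degreeHom 𝒲 (ι 𝒲 w * x)).coeff (n + 1) = ι 𝒲 w * (degreeHom 𝒲 x).coeff n := by
  rw [degreeHom_ι_mul, Polynomial.coeff_monomial_mul]

theorem coeff_zero_degreeHom (x : SymAlg 𝒲) : (degreeHom 𝒲 x).coeff 0 = aug 𝒲 x • 1 := by
  have h : (Polynomial.lcoeff (SymAlg 𝒲) 0).restrictScalars k ∘ₗ (degreeHom 𝒲).toLinearMap =
      (aug 𝒲).toLinearMap.smulRight 1 :=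
    SymAlg.linearMap_ext (by simp) fun w x _ => by
      simp [coeff_zero_degreeHom_ι_mul, aug_ι, -map_mul, map_mul (aug 𝒲)]
  exact LinearMap.congr_fun h x

/-- An element is the sum of its homogeneous components, so it vanishes as soon as all coefficients
of `degreeHom` do. -/
theorem eval_one_degreeHom (x : SymAlg 𝒲) : (degreeHom 𝒲 x).eval 1 = x := by
  have h : (Polynomial.leval (1 : SymAlg 𝒲)).restrictScalars k ∘ₗ (degreeHom 𝒲).toLinearMap =
      LinearMap.id :=
    SymAlg.linearMap_ext (by simp) fun w x hx => by
      simp only [LinearMap.comp_apply, LinearMap.restrictScalars_apply, Polynomial.leval_apply,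
        AlgHom.toLinearMap_apply, LinearMap.id_apply] at hx ⊢
      rw [degreeHom_ι_mul, ← Polynomial.C_mul_X_eq_monomial, mul_assoc, Polynomial.X_mul,
        Polynomial.eval_C_mul, Polynomial.eval_mul_X, mul_one, hx]
  exact LinearMap.congr_fun h x

variable {𝒲} [DirectSum.Decomposition 𝒲]

theorem fullExtend_smulRight_aug (w : W) (x : SymAlg 𝒲) :
    fullExtend ((aug 𝒲).toLinearMap.smulRight w) x = ι 𝒲 w * x := by
  have h : ∀ z, LinearMap.mul' k (SymAlg 𝒲)
      (TensorProduct.map (ι 𝒲 ∘ₗ (aug 𝒲).toLinearMap.smulRight w) LinearMap.id z) =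
      ι 𝒲 w * LinearMap.mul' k (SymAlg 𝒲) (TensorProduct.map (counit 𝒲) LinearMap.id z) :=
    fun z => by
      induction z using TensorProduct.induction_on with
      | zero => simp
      | add y z hy hz => simp only [map_add, hy, hz, mul_add]
      | tmul a b => simp [counit_apply]
  rw [fullExtend, LinearMap.comp_apply, LinearMap.comp_apply, h, map_counit_left]
  simp

/-- Only the terms of the diagonal with first factor of degree one survive, and their second factor
is a product of `n` elements. In the induction the leading factor `w` either is that first factor or
is absorbed into `G`; in the latter case an odd `w` twists `A` by the sign operator. -/
theorem mul_map_degreeOne_eq_zero (n : ℕ) (A : W →ₗ[k] SymAlg 𝒲) (G : SymAlg 𝒲 →ₗ[k] SymAlg 𝒲)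
    (hG : ∀ l : List W, l.length = n → G (l.map (ι 𝒲)).prod = 0) (l : List W)
    (hl : l.length = n + 1) :
    LinearMap.mul' k (SymAlg 𝒲) (TensorProduct.map (A ∘ₗ degreeOne 𝒲) G
      (fullDiagonal 𝒲 (l.map (ι 𝒲)).prod)) = 0 := by
  induction n generalizing A G l with
  | zero =>
    obtain ⟨w, rfl⟩ := List.length_eq_one_iff.1 hl
    have h1 : G 1 = 0 := hG [] rfl
    rw [List.map_singleton, List.prod_singleton, ← mul_one (ι 𝒲 w), fullDiagonal_ι_mul,
      fullDiagonal_one, mulPrim_tmul]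
    simp [h1, degreeOne_one]
  | succ n ih =>
    obtain ⟨w, l, rfl⟩ := List.exists_cons_of_length_eq_add_one hl
    have hl' : l.length = n + 1 := by simpa using hl
    have key : ∀ z, LinearMap.mul' k (SymAlg 𝒲) (TensorProduct.map (A ∘ₗ degreeOne 𝒲) G
        (mulPrim 𝒲 w z)) =
        A w * G (LinearMap.mul' k (SymAlg 𝒲) (TensorProduct.map (counit 𝒲) LinearMap.id z)) +
        LinearMap.mul' k (SymAlg 𝒲) (TensorProduct.map (A ∘ₗ degreeOne 𝒲)
          (G ∘ₗ LinearMap.mulLeft k (ι 𝒲 (proj 𝒲 0 w))) z) +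
        LinearMap.mul' k (SymAlg 𝒲) (TensorProduct.map ((A ∘ₗ sign 𝒲) ∘ₗ degreeOne 𝒲)
          (G ∘ₗ LinearMap.mulLeft k (ι 𝒲 (proj 𝒲 1 w))) z) := fun z => by
      induction z using TensorProduct.induction_on with
      | zero => simp
      | add y z hy hz =>
        simp only [map_add, hy, hz, mul_add]
        abel
      | tmul a b =>
        simp [mulPrim_tmul, degreeOne_ι_mul, degreeOne_parityAut, counit_apply]
    have hG' : ∀ v : W, ∀ l : List W, l.length = n →
        (G ∘ₗ LinearMap.mulLeft k (ι 𝒲 v)) (l.map (ι 𝒲)).prod = 0 := fun v l hl => by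
      simpa using hG (v :: l) (by simp [hl])
    rw [List.map_cons, List.prod_cons, fullDiagonal_ι_mul, key, ih _ _ (hG' _) l hl',
      ih _ _ (hG' _) l hl', map_counit_left, LinearMap.mul'_apply, one_mul, hG l hl', mul_zero,
      add_zero, add_zero]

theorem degreeOne_incl_pow_symSign_toSym (p : ZMod 2) (x : SymAlg 𝒲) :
    degreeOne 𝒲 (incl 𝒲 ((symSign 𝒲 ^ p.val) (toSym 𝒲 x))) =
      (sign 𝒲 ^ p.val) (degreeOne 𝒲 x) := by
  rcases zmod_two_cases p with rfl | rfl
  · simp [degreeOne, toSym_incl]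
  · rw [ZMod.val_one, pow_one, pow_one, ← toSym_parityAut, degreeOne_incl, ← degreeOne_parityAut]
    rfl

/-- In the diagonal of `G y`, the terms with `G` on the first factor and the two terms containing 1
have no degree-one part on the left. Only `1 ⊗ G` contributes. -/
theorem fullExtend_degreeOne_coderivation {p : ZMod 2} {G : Sym 𝒲 →ₗ[k] Sym 𝒲}
    (hG : IsCoderivation 𝒲 p G) (h : toW 𝒲 ∘ₗ G = 0) (y : Sym 𝒲) :
    fullExtend (degreeOne 𝒲) (incl 𝒲 (G y)) = LinearMap.mul' k (SymAlg 𝒲)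
      (TensorProduct.map ((ι 𝒲 ∘ₗ sign 𝒲 ^ p.val) ∘ₗ degreeOne 𝒲) (incl 𝒲 ∘ₗ G ∘ₗ toSym 𝒲)
        (fullDiagonal 𝒲 (incl 𝒲 y))) := by
  have hG0 : ∀ x, degreeOne 𝒲 (incl 𝒲 (G x)) = 0 := fun x => by
    rw [degreeOne_incl]; exact LinearMap.congr_fun h x
  have h1 : fullDiagonal 𝒲 (incl 𝒲 (G y)) =
      TensorProduct.map (incl 𝒲) (incl 𝒲) (diagonal 𝒲 (G y)) + 1 ⊗ₜ incl 𝒲 (G y) +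
        incl 𝒲 (G y) ⊗ₜ 1 := by
    rw [map_incl_diagonal]; abel
  have h2 : diagonal 𝒲 (G y) = TensorProduct.map G LinearMap.id (diagonal 𝒲 y) +
      TensorProduct.map (symSign 𝒲 ^ p.val) G (diagonal 𝒲 y) :=
    LinearMap.congr_fun hG.diagonal_comp y
  have h3 : ∀ z, LinearMap.mul' k (SymAlg 𝒲) (TensorProduct.map (ι 𝒲 ∘ₗ degreeOne 𝒲) LinearMap.id
      (TensorProduct.map (incl 𝒲) (incl 𝒲)
        (TensorProduct.map G LinearMap.id (TensorProduct.map (toSym 𝒲) (toSym 𝒲) z)))) = 0 :=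
    fun z => by
      induction z using TensorProduct.induction_on with
      | zero => simp
      | add y z hy hz => simp only [map_add, hy, hz, add_zero]
      | tmul a b => simp [hG0]
  have h4 : ∀ z, LinearMap.mul' k (SymAlg 𝒲) (TensorProduct.map (ι 𝒲 ∘ₗ degreeOne 𝒲) LinearMap.id
      (TensorProduct.map (incl 𝒲) (incl 𝒲) (TensorProduct.map (symSign 𝒲 ^ p.val) G
        (TensorProduct.map (toSym 𝒲) (toSym 𝒲) z)))) =
      LinearMap.mul' k (SymAlg 𝒲) (TensorProduct.map ((ι 𝒲 ∘ₗ sign 𝒲 ^ p.val) ∘ₗ degreeOne 𝒲)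
        (incl 𝒲 ∘ₗ G ∘ₗ toSym 𝒲) z) := fun z => by
      induction z using TensorProduct.induction_on with
      | zero => simp
      | add y z hy hz => simp only [map_add, hy, hz]
      | tmul a b => simp [degreeOne_incl_pow_symSign_toSym]
  have h5 : diagonal 𝒲 y =
      TensorProduct.map (toSym 𝒲) (toSym 𝒲) (fullDiagonal 𝒲 (incl 𝒲 y)) := rfl
  rw [fullExtend, LinearMap.comp_apply, LinearMap.comp_apply, h1, h2, h5]
  simp only [map_add, h3, h4]
  simp [hG0, degreeOne_one]

theorem IsCoderivation.sub {p : ZMod 2} {F G : Sym 𝒲 →ₗ[k] Sym 𝒲} (hF : IsCoderivation 𝒲 p F)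
    (hG : IsCoderivation 𝒲 p G) : IsCoderivation 𝒲 p (F - G) where
  parity i x hx := Submodule.sub_mem _ (hF.parity i x hx) (hG.parity i x hx)
  diagonal_comp := by
    rw [LinearMap.comp_sub, hF.diagonal_comp, hG.diagonal_comp, ← LinearMap.sub_comp]
    congr 1
    refine TensorProduct.ext' fun a b => ?_
    simp only [LinearMap.sub_apply, LinearMap.add_apply, TensorProduct.map_tmul,
      TensorProduct.sub_tmul, TensorProduct.tmul_sub]
    abel

variable [Algebra ℚ k]

/-- The Leibniz rule for the Euler operator, the derivation that is the identity on `W`. -/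
theorem fullExtend_degreeOne_ι_mul (w : W) (x : SymAlg 𝒲) :
    fullExtend (degreeOne 𝒲) (ι 𝒲 w * x) = ι 𝒲 w * x + ι 𝒲 w * fullExtend (degreeOne 𝒲) x := by
  have hpar : SignParity 0 (degreeOne 𝒲) := fun x => by
    rw [degreeOne_parityAut, sgn_zero_left, one_smul]
  have hcomp : ∀ w, degreeOne 𝒲 ∘ₗ LinearMap.mulLeft k (ι 𝒲 w) =
      (aug 𝒲).toLinearMap.smulRight w := fun w =>
    LinearMap.ext fun x => by simp [degreeOne_ι_mul]
  have hom : ∀ i, ∀ w ∈ 𝒲 i, fullExtend (degreeOne 𝒲) (ι 𝒲 w * x) =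
      ι 𝒲 w * x + ι 𝒲 w * fullExtend (degreeOne 𝒲) x := fun i w hw => by
    rw [fullExtend_ι_mul hpar hw, hcomp, fullExtend_smulRight_aug, sgn_zero_left, one_smul]
  rw [← proj_add_proj 𝒲 w, map_add, add_mul, map_add, hom 0 _ (proj_mem 𝒲 0 w),
    hom 1 _ (proj_mem 𝒲 1 w), add_mul]
  abel

theorem coeff_degreeHom_fullExtend_degreeOne (x : SymAlg 𝒲) (n : ℕ) :
    (degreeHom 𝒲 (fullExtend (degreeOne 𝒲) x)).coeff n = (n : k) • (degreeHom 𝒲 x).coeff n := by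
  induction x using SymAlg.induction generalizing n with
  | one =>
    rw [fullExtend_one, degreeOne_one, map_zero, map_zero, Polynomial.coeff_zero, map_one]
    rcases n with _ | n
    · simp
    · simp [Polynomial.coeff_one]
  | add x y hx hy => simp only [map_add, Polynomial.coeff_add, hx, hy, smul_add]
  | smul c x hx => simp only [map_smul, Polynomial.coeff_smul, hx, smul_comm c]
  | mul i w hw x hx =>
    rw [fullExtend_degreeOne_ι_mul, map_add, Polynomial.coeff_add]
    rcases n with _ | n
    · simp only [coeff_zero_degreeHom_ι_mul, add_zero, smul_zero]
    · rw [coeff_succ_degreeHom_ι_mul, coeff_succ_degreeHom_ι_mul, hx, mul_smul_comm, Nat.cast_succ,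
        add_smul, one_smul, add_comm]

theorem eq_zero_of_fullExtend_degreeOne {x : SymAlg 𝒲} (hx : aug 𝒲 x = 0)
    (h : fullExtend (degreeOne 𝒲) x = 0) : x = 0 := by
  have h0 : degreeHom 𝒲 x = 0 := by
    ext n
    rw [Polynomial.coeff_zero]
    rcases n with _ | n
    · rw [coeff_zero_degreeHom, hx, zero_smul]
    · refine natCast_smul_eq_zero (k := k) n.succ_ne_zero ?_
      rw [← coeff_degreeHom_fullExtend_degreeOne, h, map_zero, Polynomial.coeff_zero]
  rw [← eval_one_degreeHom 𝒲 x, h0, Polynomial.eval_zero]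

theorem IsCoderivation.eq_zero {p : ZMod 2} {G : Sym 𝒲 →ₗ[k] Sym 𝒲} (hG : IsCoderivation 𝒲 p G)
    (h : toW 𝒲 ∘ₗ G = 0) : G = 0 := by
  -- Induction on the number of factors: the Euler operator of the value at a product of `n + 1`
  -- elements involves `G` only on products of `n`.
  have key : ∀ n, ∀ l : List W, l.length = n →
      (incl 𝒲 ∘ₗ G ∘ₗ toSym 𝒲) (l.map (ι 𝒲)).prod = 0 := fun n => by
    induction n with
    | zero =>
      intro l hl
      rw [List.length_eq_zero_iff.1 hl]
      simp [toSym_one]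
    | succ n ih =>
      intro l hl
      refine eq_zero_of_fullExtend_degreeOne (aug_incl 𝒲 _) ?_
      have haug : aug 𝒲 (l.map (ι 𝒲)).prod = 0 := by
        obtain ⟨w, l, rfl⟩ := List.exists_cons_of_length_eq_add_one hl
        simp [aug_ι]
      simp only [LinearMap.comp_apply]
      rw [fullExtend_degreeOne_coderivation hG h, incl_toSym_of_aug 𝒲 haug]
      exact mul_map_degreeOne_eq_zero n _ _ ih l hl
  have h0 : incl 𝒲 ∘ₗ G ∘ₗ toSym 𝒲 = 0 :=
    SymAlg.linearMap_ext_prod fun l => (key _ l rfl).trans (LinearMap.zero_apply _).symm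
  refine LinearMap.ext fun x => incl_injective 𝒲 ?_
  have := LinearMap.congr_fun h0 (incl 𝒲 x)
  rw [LinearMap.comp_apply, LinearMap.comp_apply, toSym_incl] at this
  rw [this]
  simp

theorem toW_mem {i : ZMod 2} {x : Sym 𝒲} (hx : x ∈ symGrading 𝒲 i) : toW 𝒲 x ∈ 𝒲 i := by
  rw [(isSignOperator_sign 𝒲).mem_iff, ← degreeOne_incl, ← degreeOne_parityAut, ← incl_symSign,
    ((isSignOperator_symSign 𝒲).mem_iff i x).1 hx, map_smul, map_smul]

theorem IsCoderivation.toW_comp_mem {p : ZMod 2} {F : Sym 𝒲 →ₗ[k] Sym 𝒲}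
    (hF : IsCoderivation 𝒲 p F) : toW 𝒲 ∘ₗ F ∈ cochains 𝒲 p :=
  fun i x hx => toW_mem (hF.parity i x hx)

theorem IsCoderivation.eq_of_toW {p : ZMod 2} {F G : Sym 𝒲 →ₗ[k] Sym 𝒲}
    (hF : IsCoderivation 𝒲 p F) (hG : IsCoderivation 𝒲 p G) (h : toW 𝒲 ∘ₗ F = toW 𝒲 ∘ₗ G) :
    F = G :=
  sub_eq_zero.1 ((hF.sub hG).eq_zero (by rw [LinearMap.comp_sub, h, sub_self]))

theorem IsCoderivation.extend_toW {p : ZMod 2} {F : Sym 𝒲 →ₗ[k] Sym 𝒲}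
    (hF : IsCoderivation 𝒲 p F) : extend 𝒲 (toW 𝒲 ∘ₗ F) = F :=
  (isCoderivation_extend hF.toW_comp_mem).eq_of_toW hF (toW_extend _)

/-! ### The commutator of coderivations -/

/-- The graded commutator of an endomorphism of parity `p` with an odd one. -/
def commutator (p : ZMod 2) (F G : Sym 𝒲 →ₗ[k] Sym 𝒲) : Sym 𝒲 →ₗ[k] Sym 𝒲 :=
  F ∘ₗ G - sgn k p 1 • (G ∘ₗ F)

theorem IsCoderivation.symSign_apply {p : ZMod 2} {F : Sym 𝒲 →ₗ[k] Sym 𝒲}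
    (hF : IsCoderivation 𝒲 p F) (x : Sym 𝒲) : symSign 𝒲 (F x) = sgn k p 1 • F (symSign 𝒲 x) :=
  (hasParity_iff (isSignOperator_symSign 𝒲) (isSignOperator_symSign 𝒲)).1 hF.parity x

theorem pow_symSign_add (p q : ZMod 2) (x : Sym 𝒲) :
    (symSign 𝒲 ^ (p + q).val) x = (symSign 𝒲 ^ p.val) ((symSign 𝒲 ^ q.val) x) := by
  rw [pow_val_add (isSignOperator_symSign 𝒲).mul_self, Module.End.mul_apply]

theorem IsCoderivation.pow_symSign_apply {p : ZMod 2} {F : Sym 𝒲 →ₗ[k] Sym 𝒲}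
    (hF : IsCoderivation 𝒲 p F) (q : ZMod 2) (x : Sym 𝒲) :
    (symSign 𝒲 ^ q.val) (F x) = sgn k p q • F ((symSign 𝒲 ^ q.val) x) := by
  rcases zmod_two_cases q with rfl | rfl
  · simp [sgn_zero_right]
  · simp [ZMod.val_one, hF.symSign_apply]

/-- The mixed terms, in which `F` acts on one tensor factor and `G` on the other, occur in both
composites and cancel by the choice of sign. -/
theorem IsCoderivation.commutator {p : ZMod 2} {F G : Sym 𝒲 →ₗ[k] Sym 𝒲}
    (hF : IsCoderivation 𝒲 p F) (hG : IsCoderivation 𝒲 1 G) :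
    IsCoderivation 𝒲 (p + 1) (commutator p F G) where
  parity i x hx := by
    refine Submodule.sub_mem _ ?_ (Submodule.smul_mem _ _ ?_)
    · have h := hF.parity _ _ (hG.parity i x hx)
      rwa [add_assoc, add_comm 1 p] at h
    · have h := hG.parity _ _ (hF.parity i x hx)
      rwa [add_assoc] at h
  diagonal_comp := by
    have hF' : ∀ x, diagonal 𝒲 (F x) = TensorProduct.map F LinearMap.id (diagonal 𝒲 x) +
        TensorProduct.map (symSign 𝒲 ^ p.val) F (diagonal 𝒲 x) :=
      fun x => LinearMap.congr_fun hF.diagonal_comp x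
    have hG' : ∀ x, diagonal 𝒲 (G x) = TensorProduct.map G LinearMap.id (diagonal 𝒲 x) +
        TensorProduct.map (symSign 𝒲) G (diagonal 𝒲 x) := fun x => by
      have h := LinearMap.congr_fun hG.diagonal_comp x
      rwa [ZMod.val_one, pow_one] at h
    refine LinearMap.ext fun x => ?_
    simp only [LinearMap.comp_apply, LinearMap.add_apply, LInfinity.commutator,
      LinearMap.sub_apply, LinearMap.smul_apply, map_sub, map_smul, hF', hG', map_add]
    induction diagonal 𝒲 x using TensorProduct.induction_on with
    | zero => simp
    | add y z hy hz =>
      simp only [map_add, smul_add] at hy hz ⊢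
      have h := congrArg₂ (· + ·) hy hz
      refine Eq.trans ?_ (h.trans ?_)
      · abel
      · abel
    | tmul a b =>
      -- These identities, with `e3` read from right to left, move all sign operators outside `F`
      -- and `G`, so that the remaining cancellation is additive.
      have e1 : symSign 𝒲 ((symSign 𝒲 ^ p.val) a) = (symSign 𝒲 ^ (p + 1).val) a := by
        rw [add_comm, pow_symSign_add, ZMod.val_one, pow_one]
      have e2 : (symSign 𝒲 ^ p.val) (symSign 𝒲 a) = (symSign 𝒲 ^ (p + 1).val) a := by
        rw [pow_symSign_add, ZMod.val_one, pow_one]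
      have e3 : sgn k p 1 • (symSign 𝒲 ^ p.val) (G a) = G ((symSign 𝒲 ^ p.val) a) := by
        rw [hG.pow_symSign_apply, smul_smul, sgn_comm 1 p, sgn_mul_self, one_smul]
      have e4 : F (symSign 𝒲 a) = sgn k p 1 • symSign 𝒲 (F a) := by
        rw [hF.symSign_apply, smul_smul, sgn_mul_self, one_smul]
      have e5 : ∀ z : Sym 𝒲 ⊗[k] Sym 𝒲, sgn k p 1 • sgn k p 1 • z = z := fun z => by
        rw [smul_smul, sgn_mul_self, one_smul]
      simp only [TensorProduct.map_tmul, LinearMap.id_apply, LinearMap.sub_apply,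
        LinearMap.smul_apply, LinearMap.comp_apply, TensorProduct.sub_tmul, TensorProduct.tmul_sub,
        ← TensorProduct.smul_tmul', TensorProduct.tmul_smul, smul_add, e1, e2, e4, ← e3, e5]
      abel

end Uniqueness

/-! ### Codifferentials and automorphisms over `k[t]` -/

section Parameter

variable {k : Type*} [CommRing k] {W : Type*} [AddCommGroup W] [Module k W]

/-- The operator `f + t g` on `X[t]`, for `f` even: `(f + t g)(a + t b) = f a + t (g a + f b)`. -/
def tEven {X : Type*} [AddCommMonoid X] [Module k X] (f g : X →ₗ[k] X) : X × X →ₗ[k] X × X :=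
  (f ∘ₗ LinearMap.fst k X X).prod (g ∘ₗ LinearMap.fst k X X + f ∘ₗ LinearMap.snd k X X)

theorem tEven_apply {X : Type*} [AddCommMonoid X] [Module k X] (f g : X →ₗ[k] X) (x : X × X) :
    tEven f g x = (f x.1, g x.1 + f x.2) := rfl

theorem tOdd_apply {X : Type*} [AddCommMonoid X] [Module k X] (s : ZMod 2) (f g : X →ₗ[k] X)
    (x : X × X) : tOdd s f g x = (f x.1, g x.1 + sgn k s 1 • f x.2) := rfl

/-- Compare the coefficients of 1 and `t` on elements without `t`; on multiples of `t` only the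
first condition is needed, since `t² = 0`. -/
theorem tEven_comp_tOdd_eq_iff {X : Type*} [AddCommGroup X] [Module k X] {s : ZMod 2}
    {φ₀ φ₁ d f f' : X →ₗ[k] X} : tEven φ₀ φ₁ ∘ₗ tOdd s d f = tOdd s d f' ∘ₗ tEven φ₀ φ₁ ↔
      (∀ a, φ₀ (d a) = d (φ₀ a)) ∧
        ∀ a, φ₁ (d a) + φ₀ (f a) = f' (φ₀ a) + sgn k s 1 • d (φ₁ a) := by
  constructor
  · intro h
    have h' : ∀ a, _ := fun a => Prod.ext_iff.1 (LinearMap.congr_fun h (a, (0 : X)))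
    simp only [LinearMap.comp_apply, tEven_apply, tOdd_apply, map_zero, smul_zero, add_zero] at h'
    exact ⟨fun a => (h' a).1, fun a => (h' a).2⟩
  · rintro ⟨h0, h1⟩
    refine LinearMap.ext fun x => Prod.ext (h0 _) ?_
    simp only [LinearMap.comp_apply, tEven_apply, tOdd_apply, map_add, map_smul, smul_add, ← h0]
    rw [← add_assoc, h1, add_assoc]

variable {𝒲 : ZMod 2 → Submodule k W} [DirectSum.Decomposition 𝒲]

theorem mapT_tmul (s : ZMod 2) (F G : SymT 𝒲 →ₗ[k] SymT 𝒲) (a b : Sym 𝒲) :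
    mapT 𝒲 s F G (a ⊗ₜ b) = ((F (a, 0)).1 ⊗ₜ (G (b, 0)).1,
      (F (a, 0)).2 ⊗ₜ (G (b, 0)).1 + (symSign 𝒲 ^ s.val) (F (a, 0)).1 ⊗ₜ (G (b, 0)).2) := by
  simp only [mapT, TensorProduct.lift.tmul, LinearMap.compl₁₂_apply, LinearMap.comp_apply,
    LinearMap.inl_apply]
  rfl

theorem mapT_tOdd_id (s : ZMod 2) (d f : Sym 𝒲 →ₗ[k] Sym 𝒲) (z : Sym 𝒲 ⊗[k] Sym 𝒲) :
    mapT 𝒲 s (tOdd s d f) LinearMap.id z =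
      (TensorProduct.map d LinearMap.id z, TensorProduct.map f LinearMap.id z) := by
  induction z using TensorProduct.induction_on with
  | zero => simp only [map_zero, Prod.mk_zero_zero]
  | add y z hy hz => simp only [map_add, hy, hz, Prod.mk_add_mk]
  | tmul a b => simp [mapT_tmul, tOdd_apply]

theorem mapT_tEven (s : ZMod 2) (φ₀ φ₁ : Sym 𝒲 →ₗ[k] Sym 𝒲) (z : Sym 𝒲 ⊗[k] Sym 𝒲) :
    mapT 𝒲 s (tEven φ₀ φ₁) (tEven φ₀ φ₁) z =
      (TensorProduct.map φ₀ φ₀ z,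
        TensorProduct.map φ₁ φ₀ z + TensorProduct.map ((symSign 𝒲 ^ s.val) ∘ₗ φ₀) φ₁ z) := by
  induction z using TensorProduct.induction_on with
  | zero => simp only [map_zero, Prod.mk_zero_zero, add_zero]
  | add y z hy hz =>
    simp only [map_add, hy, hz, Prod.mk_add_mk, add_add_add_comm]
  | tmul a b => simp [mapT_tmul, tEven_apply]

theorem IsAutomorphismT.eq_tEven {s : ZMod 2} {Φ : SymT 𝒲 →ₗ[k] SymT 𝒲}
    (h : IsAutomorphismT 𝒲 s Φ) :
    Φ = tEven (LinearMap.fst k _ _ ∘ₗ Φ ∘ₗ LinearMap.inl k _ _)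
      (LinearMap.snd k _ _ ∘ₗ Φ ∘ₗ LinearMap.inl k _ _) := by
  refine LinearMap.ext fun x => ?_
  have e : x = (x.1, 0) + tMul k (Sym 𝒲) (x.2, 0) := by simp [tMul]
  conv_lhs => rw [e, map_add, h.map_tMul]
  simp [tMul, tEven_apply, Prod.ext_iff]

theorem IsOddCodifferentialT.eq_tOdd {s : ZMod 2} {F : SymT 𝒲 →ₗ[k] SymT 𝒲}
    (h : IsOddCodifferentialT 𝒲 s F) {d : Sym 𝒲 →ₗ[k] Sym 𝒲} (hd : ∀ a, (F (a, 0)).1 = d a) :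
    F = tOdd s d (LinearMap.snd k _ _ ∘ₗ F ∘ₗ LinearMap.inl k _ _) := by
  refine LinearMap.ext fun x => ?_
  have e : x = (x.1, 0) + tMul k (Sym 𝒲) (x.2, 0) := by simp [tMul]
  conv_lhs => rw [e, map_add, h.map_tMul]
  simp [tMul, tOdd_apply, Prod.ext_iff, hd]

theorem isAutomorphismT_tEven_id {s : ZMod 2} {f : Sym 𝒲 →ₗ[k] Sym 𝒲}
    (hf : IsCoderivation 𝒲 s f) : IsAutomorphismT 𝒲 s (tEven LinearMap.id f) where
  parity i x hx := by
    rw [add_zero]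
    exact ⟨hx.1, Submodule.add_mem _ (hf.parity i _ hx.1) hx.2⟩
  map_tMul x := by simp [tMul, tEven_apply]
  diagonal_comp a := by
    have h := LinearMap.congr_fun hf.diagonal_comp a
    simp only [LinearMap.comp_apply, LinearMap.add_apply] at h
    rw [mapT_tEven]
    simp [diagonalT, tEven_apply, h]
  bijective := by
    -- As `t² = 0`, the inverse of `1 + t f` is `1 - t f`.
    refine Function.bijective_iff_has_inverse.2 ⟨tEven LinearMap.id (-f), fun x => ?_, fun x => ?_⟩
    · simp [tEven_apply]
    · simp [tEven_apply]

variable [Algebra ℚ k]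

/-- The exponent `s + 1` combines the sign of an odd operator passing `a` with the sign of pulling
`t` out past `a`. -/
theorem mapT_signT_tOdd (s : ZMod 2) (d f : Sym 𝒲 →ₗ[k] Sym 𝒲) (z : Sym 𝒲 ⊗[k] Sym 𝒲) :
    mapT 𝒲 s (signT 𝒲 s) (tOdd s d f) z =
      (TensorProduct.map (symSign 𝒲) d z,
        TensorProduct.map (symSign 𝒲 ^ (s + 1).val) f z) := by
  induction z using TensorProduct.induction_on with
  | zero => simp only [map_zero, Prod.mk_zero_zero]
  | add y z hy hz => simp only [map_add, hy, hz, Prod.mk_add_mk]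
  | tmul a b => simp [mapT_tmul, tOdd_apply, signT, pow_symSign_add, ZMod.val_one]

theorem isOddCodifferentialT_tOdd_iff {s : ZMod 2} {d f : Sym 𝒲 →ₗ[k] Sym 𝒲}
    (hd : IsCoderivation 𝒲 1 d) (hdd : d ∘ₗ d = 0) :
    IsOddCodifferentialT 𝒲 s (tOdd s d f) ↔
      IsCoderivation 𝒲 (s + 1) f ∧ commutator (s + 1) f d = 0 := by
  have hdiag : ∀ a, (mapT 𝒲 s (tOdd s d f) LinearMap.id +
      mapT 𝒲 s (signT 𝒲 s) (tOdd s d f)) (diagonal 𝒲 a) = (diagonal 𝒲 (d a),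
      TensorProduct.map f LinearMap.id (diagonal 𝒲 a) +
        TensorProduct.map (symSign 𝒲 ^ (s + 1).val) f (diagonal 𝒲 a)) := fun a => by
    have h := LinearMap.congr_fun hd.diagonal_comp a
    simp only [LinearMap.comp_apply, ZMod.val_one, pow_one] at h
    rw [h, LinearMap.add_apply, mapT_tOdd_id, mapT_signT_tOdd, Prod.mk_add_mk]
    rfl
  -- The right-hand side is the coefficient of `t` in the square of `d + t f`.
  have hcomm : ∀ a, commutator (s + 1) f d a = f (d a) + sgn k s 1 • d (f a) := fun a => by
    simp [commutator, sgn_add_one, sgn_one_one]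
  have hdd' : ∀ a, d (d a) = 0 := LinearMap.congr_fun hdd
  constructor
  · intro h
    refine ⟨⟨fun i x hx => ?_, LinearMap.ext fun a => ?_⟩, LinearMap.ext fun a => ?_⟩
    · have h1 := (h.parity i (x, 0) ⟨hx, zero_mem _⟩).2
      simp only [tOdd_apply, map_zero, smul_zero, add_zero] at h1
      rwa [add_comm s 1, ← add_assoc]
    · have h1 := congrArg Prod.snd (h.diagonal_comp a)
      rw [hdiag] at h1
      simpa [diagonalT, tOdd_apply] using h1
    · have h1 := congrArg Prod.snd (LinearMap.congr_fun h.comp_self (a, 0))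
      rw [hcomm]
      simpa [tOdd_apply] using h1
  · rintro ⟨hf, h⟩
    refine ⟨fun i x hx => ⟨hd.parity i _ hx.1, ?_⟩, fun x => ?_, fun a => ?_,
      LinearMap.ext fun x => ?_⟩
    · have h1 := hf.parity i _ hx.1
      have h2 := hd.parity _ _ hx.2
      rw [add_comm s 1, ← add_assoc] at h1
      rw [add_assoc, add_comm s 1, ← add_assoc] at h2
      exact Submodule.add_mem _ h1 (Submodule.smul_mem _ _ h2)
    · simp [tMul, tOdd_apply]
    · rw [hdiag]
      have h1 := LinearMap.congr_fun hf.diagonal_comp a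
      rw [LinearMap.comp_apply, LinearMap.comp_apply, LinearMap.add_apply] at h1
      rw [← h1]
      simp [diagonalT, tOdd_apply]
    · have h1 := hcomm x.1
      rw [h, LinearMap.zero_apply] at h1
      simp [tOdd_apply, hdd', ← h1]

/-- The constant term of the compatibility with the diagonal says that `φ₀` is a coalgebra map, and
the coefficient of `t` that `φ₁` is a coderivation along `φ₀`. Composing with `φ₀⁻¹` makes it a
genuine coderivation. -/
theorem IsAutomorphismT.exists_isCoderivation {s : ZMod 2} {φ₀ φ₁ : Sym 𝒲 →ₗ[k] Sym 𝒲}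
    (h : IsAutomorphismT 𝒲 s (tEven φ₀ φ₁)) :
    ∃ e : Sym 𝒲 ≃ₗ[k] Sym 𝒲, e.toLinearMap = φ₀ ∧
      IsCoderivation 𝒲 s (φ₁ ∘ₗ e.symm.toLinearMap) := by
  have hinj : Function.Injective φ₀ := by
    refine (injective_iff_map_eq_zero φ₀).2 fun b hb => ?_
    -- Injectivity is tested on `t b`, which is sent to `t φ₀(b)`.
    have h1 : tEven φ₀ φ₁ (0, b) = tEven φ₀ φ₁ 0 := by simp [tEven_apply, hb]
    exact congrArg Prod.snd (h.bijective.1 h1)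
  have hsurj : Function.Surjective φ₀ := fun y => by
    obtain ⟨x, hx⟩ := h.bijective.2 (y, 0)
    exact ⟨x.1, congrArg Prod.fst hx⟩
  obtain ⟨e, he⟩ : ∃ e : Sym 𝒲 ≃ₗ[k] Sym 𝒲, e.toLinearMap = φ₀ :=
    ⟨LinearEquiv.ofBijective φ₀ ⟨hinj, hsurj⟩, rfl⟩
  subst he
  have hS := isSignOperator_symSign 𝒲
  have h0 : ∀ x, symSign 𝒲 (e x) = e (symSign 𝒲 x) := fun x => by
    have hp : HasParity (symGrading 𝒲) (symGrading 𝒲) 0 e.toLinearMap := fun i x hx =>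
      (h.parity i (x, 0) ⟨hx, zero_mem _⟩).1
    simpa [sgn_zero_left] using (hasParity_iff hS hS).1 hp x
  have h0' : ∀ x, symSign 𝒲 (e.symm x) = e.symm (symSign 𝒲 x) := fun x => by
    rw [LinearEquiv.eq_symm_apply, ← h0, e.apply_symm_apply]
  have h1 : ∀ x, symSign 𝒲 (φ₁ x) = sgn k s 1 • φ₁ (symSign 𝒲 x) := by
    refine (hasParity_iff hS hS).1 fun i x hx => ?_
    simpa [tEven_apply] using (h.parity i (x, 0) ⟨hx, zero_mem _⟩).2
  refine ⟨e, rfl, ?_, LinearMap.ext fun x => ?_⟩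
  · rw [hasParity_iff hS hS]
    intro x
    simp only [LinearMap.comp_apply, LinearEquiv.coe_coe, h1, h0']
  · obtain ⟨y, rfl⟩ := e.surjective x
    have hd := Prod.ext_iff.1 (h.diagonal_comp y)
    rw [mapT_tEven] at hd
    simp only [diagonalT, tEven_apply, LinearMap.prodMap_apply, LinearEquiv.coe_coe, map_zero,
      add_zero] at hd
    simp only [LinearMap.comp_apply, LinearEquiv.coe_coe, e.symm_apply_apply]
    rw [hd.1, hd.2]
    induction diagonal 𝒲 y using TensorProduct.induction_on with
    | zero => simp
    | add y z hy hz => rw [map_add, map_add, map_add, map_add, add_add_add_comm, hy, hz]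
    | tmul a b => simp

end Parameter

/-! ### Deformations and cohomology -/

namespace LInfinityStructure

variable {k : Type*} [CommRing k] {V : Type*} [AddCommGroup V] [Module k V]
  {𝒱 : ZMod 2 → Submodule k V} [DirectSum.Decomposition 𝒱] (L : LInfinityStructure 𝒱)

variable {L} in
theorem mem_coboundaries_iff {s : ZMod 2} {δ : Cochain (parityRev 𝒱)} :
    δ ∈ L.coboundaries (s + 1) ↔ ∃ φ ∈ cochains (parityRev 𝒱) s, L.D s φ = δ := by
  rw [coboundaries, add_self_cancel, Submodule.mem_map]

theorem deform_injective (s : ZMod 2) : Function.Injective (L.deform s) := fun δ δ' h => by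
  rw [← toW_extend δ, ← toW_extend δ']
  congr 1
  refine LinearMap.ext fun a => ?_
  simpa [deform, tOdd_apply] using congrArg Prod.snd (LinearMap.congr_fun h (a, 0))

variable [Algebra ℚ k]

theorem extend_l : extend (parityRev 𝒱) L.l = L.d := L.isCoderivation.extend_toW

/-- The bracket of cochains is the degree-one part of the commutator of coderivations, because `d`
is the extension of `l`. -/
theorem D_apply (p : ZMod 2) (φ : Cochain (parityRev 𝒱)) :
    L.D p φ = toW (parityRev 𝒱) ∘ₗ commutator p (extend (parityRev 𝒱) φ) L.d := by
  rw [commutator, LinearMap.comp_sub, LinearMap.comp_smul, ← LinearMap.comp_assoc,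
    ← LinearMap.comp_assoc, toW_extend]
  change φ ∘ₗ extend (parityRev 𝒱) L.l - _ = _
  rw [extend_l]
  rfl

variable {L} {p : ZMod 2} {φ : Cochain (parityRev 𝒱)}

theorem extend_D (hφ : φ ∈ cochains (parityRev 𝒱) p) :
    extend (parityRev 𝒱) (L.D p φ) = commutator p (extend (parityRev 𝒱) φ) L.d := by
  rw [D_apply]
  exact ((isCoderivation_extend hφ).commutator L.isCoderivation).extend_toW

theorem D_mem (hφ : φ ∈ cochains (parityRev 𝒱) p) : L.D p φ ∈ cochains (parityRev 𝒱) (p + 1) := by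
  rw [D_apply]
  exact ((isCoderivation_extend hφ).commutator L.isCoderivation).toW_comp_mem

theorem D_D (hφ : φ ∈ cochains (parityRev 𝒱) p) : L.D (p + 1) (L.D p φ) = 0 := by
  have hdd : ∀ a, L.d (L.d a) = 0 := LinearMap.congr_fun L.comp_self
  have h : commutator (p + 1) (commutator p (extend (parityRev 𝒱) φ) L.d) L.d = 0 :=
    LinearMap.ext fun x => by simp [commutator, hdd, sgn_add_one, sgn_one_one]
  rw [D_apply, extend_D hφ, h, LinearMap.comp_zero]

theorem D_eq_zero_iff (hφ : φ ∈ cochains (parityRev 𝒱) p) :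
    L.D p φ = 0 ↔ commutator p (extend (parityRev 𝒱) φ) L.d = 0 := by
  rw [← extend_D hφ]
  exact ⟨fun h => by rw [h, map_zero], fun h => by
    rw [← toW_extend (L.D p φ), h, LinearMap.comp_zero]⟩

variable (L) in
theorem coboundaries_le_cocycles (p : ZMod 2) : L.coboundaries p ≤ L.cocycles p := by
  rintro _ ⟨φ, hφ, rfl⟩
  have h1 := D_mem (L := L) hφ
  have h2 := D_D (L := L) hφ
  rw [add_self_cancel] at h1 h2
  exact ⟨h1, h2⟩

variable {s : ZMod 2} {δ δ' : Cochain (parityRev 𝒱)}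

theorem isInfinitesimalDeformation_deform_iff (hδ : δ ∈ cochains (parityRev 𝒱) (s + 1)) :
    L.IsInfinitesimalDeformation s (L.deform s δ) ↔ δ ∈ L.cocycles (s + 1) := by
  have h := isOddCodifferentialT_tOdd_iff (s := s) (f := extend (parityRev 𝒱) δ) L.isCoderivation
    L.comp_self
  rw [cocycles, Submodule.mem_inf, LinearMap.mem_ker, D_eq_zero_iff hδ]
  exact ⟨fun hF => ⟨hδ, (h.1 hF.1).2⟩,
    fun hF => ⟨h.2 ⟨isCoderivation_extend hδ, hF.2⟩, fun _ => rfl⟩⟩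

theorem IsInfinitesimalDeformation.exists_deform {F : SymT (parityRev 𝒱) →ₗ[k] SymT (parityRev 𝒱)}
    (hF : L.IsInfinitesimalDeformation s F) :
    ∃ δ ∈ cochains (parityRev 𝒱) (s + 1), F = L.deform s δ := by
  have e := hF.1.eq_tOdd hF.2
  have h := hF.1
  rw [e, isOddCodifferentialT_tOdd_iff L.isCoderivation L.comp_self] at h
  refine ⟨_, h.1.toW_comp_mem, ?_⟩
  rw [deform, h.1.extend_toW]
  exact e

theorem equivalentDeformations_deform_iff :
    EquivalentDeformations (parityRev 𝒱) s (L.deform s δ) (L.deform s δ') ↔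
      δ' - δ ∈ L.coboundaries (s + 1) := by
  rw [mem_coboundaries_iff]
  constructor
  · rintro ⟨Φ, hΦ, hid, h⟩
    have e := hΦ.eq_tEven
    have e0 : LinearMap.fst k _ _ ∘ₗ Φ ∘ₗ LinearMap.inl k _ _ = LinearMap.id :=
      LinearMap.ext hid
    rw [e0] at e
    generalize LinearMap.snd k _ _ ∘ₗ Φ ∘ₗ LinearMap.inl k _ _ = f at e
    subst e
    -- Here `φ₀` is the identity, so the coderivation obtained is `f` itself.
    obtain ⟨e, he, hf⟩ := hΦ.exists_isCoderivation
    have he' : e = LinearEquiv.refl k _ := LinearEquiv.toLinearMap_injective he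
    subst he'
    replace hf : IsCoderivation (parityRev 𝒱) s f := hf
    have h1 := (tEven_comp_tOdd_eq_iff.1 h).2
    refine ⟨_, hf.toW_comp_mem, ?_⟩
    rw [D_apply, hf.extend_toW, ← toW_extend (δ' - δ)]
    congr 1
    refine LinearMap.ext fun a => ?_
    have h2 := h1 a
    simp only [LinearMap.id_apply] at h2
    simp only [commutator, LinearMap.sub_apply, LinearMap.comp_apply, LinearMap.smul_apply, map_sub]
    rw [sub_eq_sub_iff_add_eq_add, h2]
  · rintro ⟨φ, hφ, hD⟩
    have hf := isCoderivation_extend hφ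
    refine ⟨_, isAutomorphismT_tEven_id hf, fun _ => rfl, tEven_comp_tOdd_eq_iff.2
      ⟨fun _ => rfl, fun a => ?_⟩⟩
    have h1 := LinearMap.congr_fun (extend_D (L := L) hφ) a
    rw [hD] at h1
    simp only [commutator, LinearMap.sub_apply, LinearMap.comp_apply, LinearMap.smul_apply,
      map_sub] at h1
    simp only [LinearMap.id_apply]
    rw [← sub_eq_sub_iff_add_eq_add, h1]

theorem isTrivialDeformation_deform_iff :
    L.IsTrivialDeformation s (L.deform s δ) ↔ δ ∈ L.coboundaries (s + 1) := by
  constructor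
  · rintro ⟨Φ, hΦ, h⟩
    have e := hΦ.eq_tEven
    generalize LinearMap.fst k _ _ ∘ₗ Φ ∘ₗ LinearMap.inl k _ _ = φ₀ at e
    generalize LinearMap.snd k _ _ ∘ₗ Φ ∘ₗ LinearMap.inl k _ _ = φ₁ at e
    subst e
    obtain ⟨e, rfl, hf⟩ := hΦ.exists_isCoderivation
    obtain ⟨h0, h1⟩ := tEven_comp_tOdd_eq_iff.1 h
    simp only [LinearEquiv.coe_coe, map_zero, LinearMap.zero_apply, add_zero] at h0 h1
    refine mem_coboundaries_iff.2 ⟨_, hf.toW_comp_mem, ?_⟩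
    rw [D_apply, hf.extend_toW, ← toW_extend δ]
    congr 1
    refine LinearMap.ext fun x => ?_
    obtain ⟨y, rfl⟩ := e.surjective x
    simp only [commutator, LinearMap.sub_apply, LinearMap.comp_apply, LinearMap.smul_apply,
      LinearEquiv.coe_coe, e.symm_apply_apply, ← h0]
    rw [h1, add_sub_cancel_right]
  · intro h
    obtain ⟨Φ, hΦ, -, h⟩ :=
      -- A coboundary is even reached by an automorphism that is the identity modulo `t`.
      equivalentDeformations_deform_iff.2 (show δ - 0 ∈ L.coboundaries (s + 1) by rwa [sub_zero])
    exact ⟨Φ, hΦ, h⟩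

end LInfinityStructure

end

end LInfinity

/-! ### The classification theorem. -/

theorem mainTheorem4 {k : Type*} [CommRing k] [Algebra ℚ k] {V : Type*} [AddCommGroup V]
    [Module k V] (𝒱 : ZMod 2 → Submodule k V) [DirectSum.Decomposition 𝒱]
    (L : LInfinity.LInfinityStructure 𝒱) :
    -- `D` is a differential
    (∀ p : ZMod 2, L.coboundaries p ≤ L.cocycles p) ∧
    -- for a parameter `t` of either parity `s`
    ∀ s : ZMod 2,
      -- `d + t δ` is an infinitesimal deformation if and only if `δ` is a cocycle
      (∀ δ ∈ LInfinity.cochains (LInfinity.parityRev 𝒱) (s + 1),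
        L.IsInfinitesimalDeformation s (L.deform s δ) ↔ δ ∈ L.cocycles (s + 1)) ∧
      -- every infinitesimal deformation has this form, for a unique `δ`
      (∀ F, L.IsInfinitesimalDeformation s F →
        ∃! δ, δ ∈ LInfinity.cochains (LInfinity.parityRev 𝒱) (s + 1) ∧ F = L.deform s δ) ∧
      -- `d + t δ` is trivial if and only if `δ` is a coboundary
      (∀ δ ∈ LInfinity.cochains (LInfinity.parityRev 𝒱) (s + 1),
        L.IsTrivialDeformation s (L.deform s δ) ↔ δ ∈ L.coboundaries (s + 1)) ∧
      -- `d + t δ ↦ [δ]` is a bijection from the equivalence classes to the cohomology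
      ∃ cls : {F // L.IsInfinitesimalDeformation s F} → L.H (s + 1),
        (∀ (F : {F // L.IsInfinitesimalDeformation s F}) (δ : L.cocycles (s + 1)),
          F.1 = L.deform s δ → cls F = Submodule.Quotient.mk δ) ∧
        Function.Surjective cls ∧
        ∀ F F' : {F // L.IsInfinitesimalDeformation s F},
          cls F = cls F' ↔
            LInfinity.EquivalentDeformations (LInfinity.parityRev 𝒱) s F.1 F'.1 := by
  refine ⟨L.coboundaries_le_cocycles, fun s => ⟨fun δ hδ =>
    LInfinity.LInfinityStructure.isInfinitesimalDeformation_deform_iff hδ, fun F hF => ?_,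
    fun _ _ => LInfinity.LInfinityStructure.isTrivialDeformation_deform_iff, ?_⟩⟩
  · obtain ⟨δ, hδ, h⟩ := hF.exists_deform
    exact ⟨δ, ⟨hδ, h⟩, fun δ' h' =>
      L.deform_injective s (h'.2.symm.trans h)⟩
  · have hex : ∀ F : {F // L.IsInfinitesimalDeformation s F},
        ∃ δ : L.cocycles (s + 1), F.1 = L.deform s δ := fun F => by
      obtain ⟨δ, hδ, h⟩ := F.2.exists_deform
      exact ⟨⟨δ, (LInfinity.LInfinityStructure.isInfinitesimalDeformation_deform_iff hδ).1
        (h ▸ F.2)⟩, h⟩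
    choose δ hδ using hex
    have hcls : ∀ (F : {F // L.IsInfinitesimalDeformation s F}) (δ' : L.cocycles (s + 1)),
        F.1 = L.deform s δ' → δ F = δ' := fun F δ' h =>
      Subtype.ext (L.deform_injective s ((hδ F).symm.trans h))
    refine ⟨fun F => Submodule.Quotient.mk (δ F), fun F δ' h => congrArg _ (hcls F δ' h),
      fun c => ?_, fun F F' => ?_⟩
    · obtain ⟨δ', rfl⟩ := Submodule.Quotient.mk_surjective _ c
      exact ⟨⟨L.deform s δ', (LInfinity.LInfinityStructure.isInfinitesimalDeformation_deform_iff
        δ'.2.1).2 δ'.2⟩, congrArg _ (hcls _ δ' rfl)⟩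
    -- The symmetry puts the difference in the order `δ F' - δ F` of the equivalence criterion.
    · rw [eq_comm, Submodule.Quotient.eq, hδ F, hδ F',
        LInfinity.LInfinityStructure.equivalentDeformations_deform_iff]
      rfl
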